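/- Let $R$ be a commutative profinite ring and $G$ a profinite group, and write $R[\![G]\!]=\varprojlim_U R[G/U]$ (over the open normal subgroups $U$ of $G$) for the complete group algebra. For $0\le n\le\infty$ we say that $G$ is of type $\mathrm{FP}_n$ over $R$ if $R$, viewed as a profinite left $R[\![G]\!]$-module with trivial $G$-action, has a projective resolution $\cdots\to P_1\to P_0\to R\to 0$ in the category of profinite left $R[\![G]\!]$-modules (with continuous homomorphisms) such that $P_i$ is finitely generated for every integer $i$ with $0\le i\le n$. Then: 1. If $H$ is an open subgroup of $G$ and $0\le n\le\infty$, then $H$ is of type $\mathrm{FP}_n$ over $R$ if and only if $G$ is of type $\mathrm{FP}_n$ over $R$. 2. In particular, if $G$ is finite, then $G$ is of type $\mathrm{FP}_\infty$ over $R$. -/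

import Mathlib

open scoped MonoidAlgebra

universe u v w

/-- The whole group as an open normal subgroup. -/
def OpenNormalSubgroup.whole (G : Type u) [Group G] [TopologicalSpace G] :
    OpenNormalSubgroup G where
  toSubgroup := ⊤
  isOpen' := isOpen_univ

/-- For open normal subgroups `U ≤ V` of `G`, the canonical ring homomorphism
`R[G ⧸ U] → R[G ⧸ V]` induced by the projection `G ⧸ U → G ⧸ V`. -/
noncomputable def groupAlgebraTransition (R : Type v) [CommRing R] {G : Type u} [Group G]
    [TopologicalSpace G] (U V : OpenNormalSubgroup G) (h : U.toSubgroup ≤ V.toSubgroup) :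
    R[G ⧸ U.toSubgroup] →+* R[G ⧸ V.toSubgroup] :=
  MonoidAlgebra.mapDomainRingHom R
    (QuotientGroup.map U.toSubgroup V.toSubgroup (MonoidHom.id G) h)

/-- The inverse limit of the group algebras `R[G ⧸ U]` over the open normal subgroups `U` of `G`,
as a subring of their product: the compatible families. -/
noncomputable def completeGroupAlgebraSubring (R : Type v) [CommRing R] (G : Type u) [Group G]
    [TopologicalSpace G] : Subring (∀ U : OpenNormalSubgroup G, R[G ⧸ U.toSubgroup]) where
  carrier := {x | ∀ (U V : OpenNormalSubgroup G) (h : U.toSubgroup ≤ V.toSubgroup),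
    groupAlgebraTransition R U V h (x U) = x V}
  zero_mem' := fun U V h => map_zero _
  one_mem' := fun U V h => map_one _
  add_mem' := fun hx hy U V h => by simp only [Pi.add_apply, map_add, hx U V h, hy U V h]
  mul_mem' := fun hx hy U V h => by simp only [Pi.mul_apply, map_mul, hx U V h, hy U V h]
  neg_mem' := fun hx U V h => by simp only [Pi.neg_apply, map_neg, hx U V h]

/-- The complete group algebra `R⟦G⟧`, the inverse limit of the group algebras `R[G ⧸ U]` over the
open normal subgroups `U` of `G`. -/
abbrev CompleteGroupAlgebra (R : Type v) [CommRing R] (G : Type u) [Group G]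
    [TopologicalSpace G] : Type (max u v) :=
  completeGroupAlgebraSubring R G

namespace CompleteGroupAlgebra

section Basic

variable (R : Type v) [CommRing R] (G : Type u) [Group G] [TopologicalSpace G]

/-- The coefficients of all components of an element of `R⟦G⟧`. -/
def coeffs (x : CompleteGroupAlgebra R G) :
    ∀ U : OpenNormalSubgroup G, G ⧸ U.toSubgroup → R :=
  fun U q => (x.1 U).coeff q

/-- The inverse limit topology on `R⟦G⟧`, where each `R[G ⧸ U]` carries the topology of pointwise
convergence of coefficients (for finite `G ⧸ U`, this is the product topology of copies of `R`
indexed by `G ⧸ U`). -/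
instance instTopologicalSpace [TopologicalSpace R] :
    TopologicalSpace (CompleteGroupAlgebra R G) :=
  TopologicalSpace.induced (coeffs R G) inferInstance

/-- The augmentation `R⟦G⟧ → R`, the continuous `R`-algebra homomorphism sending every group
element to `1`. It is the projection to the component `R[G ⧸ G]` followed by the sum of the
coefficients. -/
noncomputable def augmentation : CompleteGroupAlgebra R G →+* R :=
  ((MonoidAlgebra.lift R R (G ⧸ (OpenNormalSubgroup.whole G).toSubgroup) 1).toRingHom.comp
    (Pi.evalRingHom (fun U : OpenNormalSubgroup G => R[G ⧸ U.toSubgroup])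
      (OpenNormalSubgroup.whole G))).comp (completeGroupAlgebraSubring R G).subtype

theorem coeffs_injective : Function.Injective (coeffs R G) := by
  intro x y h
  apply Subtype.ext
  funext U
  apply MonoidAlgebra.coeff_injective
  ext q
  exact congrFun (congrFun h U) q

variable [TopologicalSpace R]

theorem continuous_coeffs : Continuous (coeffs R G) := continuous_induced_dom

theorem continuous_coeff (U : OpenNormalSubgroup G) (q : G ⧸ U.toSubgroup) :
    Continuous fun x : CompleteGroupAlgebra R G => (x.1 U).coeff q :=
  (continuous_apply q).comp ((continuous_apply U).comp (continuous_coeffs R G))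

theorem continuous_iff {X : Type*} [TopologicalSpace X] {f : X → CompleteGroupAlgebra R G} :
    Continuous f ↔ ∀ (U : OpenNormalSubgroup G) (q : G ⧸ U.toSubgroup),
      Continuous fun x => ((f x).1 U).coeff q := by
  rw [continuous_induced_rng, continuous_pi_iff]
  simp only [continuous_pi_iff]
  rfl

instance instT2Space [T2Space R] : T2Space (CompleteGroupAlgebra R G) :=
  T2Space.of_injective_continuous (coeffs_injective R G) (continuous_coeffs R G)

instance instTotallyDisconnectedSpace [TotallyDisconnectedSpace R] :
    TotallyDisconnectedSpace (CompleteGroupAlgebra R G) :=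
  (Topology.IsEmbedding.isTotallyDisconnected_range ⟨⟨rfl⟩, coeffs_injective R G⟩).1
    (isTotallyDisconnected_of_totallyDisconnectedSpace _)

theorem continuous_augmentation [IsTopologicalRing R] : Continuous (augmentation R G) := by
  have hs : Subsingleton (G ⧸ (OpenNormalSubgroup.whole G).toSubgroup) :=
    QuotientGroup.subsingleton_quotient_top
  have key : ∀ x : CompleteGroupAlgebra R G,
      augmentation R G x = (x.1 (OpenNormalSubgroup.whole G)).coeff 1 := by
    intro x
    change MonoidAlgebra.lift R R _ 1 (x.1 (OpenNormalSubgroup.whole G)) = _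
    rw [MonoidAlgebra.lift_apply, Finsupp.sum_eq_single 1]
    · simp
    · exact fun b _ hb => (hb (Subsingleton.elim _ _)).elim
    · simp
  simp_rw [funext key]
  exact continuous_coeff R G _ _

end Basic

section Profinite

variable (R : Type v) [CommRing R] [TopologicalSpace R] [IsTopologicalRing R]
  (G : Type u) [Group G] [TopologicalSpace G] [IsTopologicalGroup G] [CompactSpace G]

instance instIsTopologicalRing : IsTopologicalRing (CompleteGroupAlgebra R G) where
  continuous_add := by
    rw [continuous_iff]
    intro U q
    exact ((continuous_coeff R G U q).comp continuous_fst).add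
      ((continuous_coeff R G U q).comp continuous_snd)
  continuous_neg := by
    rw [continuous_iff]
    intro U q
    exact (continuous_coeff R G U q).neg
  continuous_mul := by
    rw [continuous_iff]
    intro U q
    have : Finite (G ⧸ U.toSubgroup) := U.toSubgroup.quotient_finite_of_isOpen U.isOpen'
    have := Fintype.ofFinite (G ⧸ U.toSubgroup)
    have key : ∀ x y : CompleteGroupAlgebra R G, ((x * y).1 U).coeff q =
        ∑ p, (x.1 U).coeff p * (y.1 U).coeff (p⁻¹ * q) := by
      intro x y
      change ((x.1 U) * (y.1 U)).coeff q = _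
      rw [MonoidAlgebra.coeff_mul_apply_left, Finsupp.sum_fintype]
      simp
    simp_rw [key]
    exact continuous_finsetSum _ fun p _ =>
      ((continuous_coeff R G U p).comp continuous_fst).mul
        ((continuous_coeff R G U _).comp continuous_snd)

instance instCompactSpace [CompactSpace R] [T2Space R] :
    CompactSpace (CompleteGroupAlgebra R G) := by
  classical
  have hfin : ∀ U : OpenNormalSubgroup G, Finite (G ⧸ U.toSubgroup) := fun U =>
    U.toSubgroup.quotient_finite_of_isOpen U.isOpen'
  have hft : ∀ U : OpenNormalSubgroup G, Fintype (G ⧸ U.toSubgroup) := fun U =>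
    Fintype.ofFinite _
  have key : ∀ (U V : OpenNormalSubgroup G) (h : U.toSubgroup ≤ V.toSubgroup)
      (a : R[G ⧸ U.toSubgroup]) (q : G ⧸ V.toSubgroup),
      (groupAlgebraTransition R U V h a).coeff q =
        ∑ p, if QuotientGroup.map U.toSubgroup V.toSubgroup (MonoidHom.id G) h p = q
          then a.coeff p else 0 := by
    intro U V h a q
    change (Finsupp.mapDomain _ a.coeff) q = _
    rw [Finsupp.mapDomain, Finsupp.sum_fintype _ _ (by simp), Finsupp.finsetSum_apply]
    exact Finset.sum_congr rfl fun p _ => Finsupp.single_apply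
  have hrange : Set.range (coeffs R G) =
      ⋂ (U : OpenNormalSubgroup G) (V : OpenNormalSubgroup G)
        (h : U.toSubgroup ≤ V.toSubgroup) (q : G ⧸ V.toSubgroup),
        {c : ∀ U : OpenNormalSubgroup G, G ⧸ U.toSubgroup → R |
          (∑ p, if QuotientGroup.map U.toSubgroup V.toSubgroup (MonoidHom.id G) h p = q
            then c U p else 0) = c V q} := by
    ext c
    simp only [Set.mem_range, Set.mem_iInter, Set.mem_ofPred_eq]
    constructor
    · rintro ⟨x, rfl⟩ U V h q
      refine (key U V h (x.1 U) q).symm.trans ?_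
      rw [x.2 U V h]
      rfl
    · intro hc
      refine ⟨⟨fun U => MonoidAlgebra.ofCoeff (Finsupp.equivFunOnFinite.symm (c U)), ?_⟩, rfl⟩
      intro U V h
      apply MonoidAlgebra.coeff_injective
      ext q
      rw [key]
      exact hc U V h q
  have hclosed : IsClosed (Set.range (coeffs R G)) := by
    rw [hrange]
    refine isClosed_iInter fun U => isClosed_iInter fun V => isClosed_iInter fun h =>
      isClosed_iInter fun q => isClosed_eq ?_ (by fun_prop)
    refine continuous_finsetSum _ fun p _ => ?_
    split_ifs <;> fun_prop
  exact (Topology.IsClosedEmbedding.mk ⟨⟨rfl⟩, coeffs_injective R G⟩ hclosed).compactSpace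

end Profinite

end CompleteGroupAlgebra

/-- A profinite left module over a topological ring `Λ`: a compact, Hausdorff, totally disconnected
topological left `Λ`-module. -/
structure ProfiniteModule (Λ : Type u) [Ring Λ] [TopologicalSpace Λ] where
  carrier : Type w
  [addCommGroup : AddCommGroup carrier]
  [module : Module Λ carrier]
  [topologicalSpace : TopologicalSpace carrier]
  [isTopologicalAddGroup : IsTopologicalAddGroup carrier]
  [continuousSMul : ContinuousSMul Λ carrier]
  [compactSpace : CompactSpace carrier]
  [t2Space : T2Space carrier]
  [totallyDisconnectedSpace : TotallyDisconnectedSpace carrier]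

namespace ProfiniteModule

attribute [instance] addCommGroup module topologicalSpace isTopologicalAddGroup continuousSMul
  compactSpace t2Space totallyDisconnectedSpace

section

variable {Λ : Type u} [Ring Λ] [TopologicalSpace Λ]

instance : CoeSort (ProfiniteModule.{u, w} Λ) (Type w) := ⟨carrier⟩

/-- A profinite module is finitely generated if some finite subset generates a dense submodule. -/
def IsFinitelyGenerated (M : ProfiniteModule.{u, w} Λ) : Prop :=
  ∃ S : Finset M, Dense (Submodule.span Λ (S : Set M) : Set M)

/-- A profinite module `P` is projective if every continuous homomorphism from `P` to `B` lifts
along every continuous surjective homomorphism `A → B` of profinite modules. -/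
def IsProjective (P : ProfiniteModule.{u, max u w} Λ) : Prop :=
  ∀ (A B : ProfiniteModule.{u, max u w} Λ) (f : A →L[Λ] B) (g : P →L[Λ] B),
    Function.Surjective f → ∃ h : P →L[Λ] A, f.comp h = g

/-- A projective resolution `⋯ → X 2 → X 1 → X 0 → A → 0` of the profinite module `A` by profinite
modules. -/
structure ProjectiveResolution (A : ProfiniteModule.{u, w} Λ) where
  X : ℕ → ProfiniteModule.{u, max u w} Λ
  d : ∀ i, X (i + 1) →L[Λ] X i
  ε : X 0 →L[Λ] A
  projective : ∀ i, IsProjective.{u, w} (X i)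
  surjective_ε : Function.Surjective ε
  exact_zero : Function.Exact (d 0) ε
  exact_succ : ∀ i, Function.Exact (d (i + 1)) (d i)

/-- `A` is of type `FP_n`, `n ≤ ∞`: it has a projective resolution whose terms in all degrees
`i ≤ n` are finitely generated. -/
def IsFP (A : ProfiniteModule.{u, w} Λ) (n : ℕ∞) : Prop :=
  ∃ P : ProjectiveResolution.{u, w} A, ∀ i : ℕ, (i : ℕ∞) ≤ n → (P.X i).IsFinitelyGenerated

end

/-- `R` as a profinite `R⟦G⟧`-module with trivial `G`-action: `R⟦G⟧` acts through the
augmentation. -/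
noncomputable def trivial (R : Type v) [CommRing R] [TopologicalSpace R] [IsTopologicalRing R]
    [CompactSpace R] [T2Space R] [TotallyDisconnectedSpace R]
    (G : Type u) [Group G] [TopologicalSpace G] :
    ProfiniteModule.{max u v, v} (CompleteGroupAlgebra R G) :=
  letI : Module (CompleteGroupAlgebra R G) R :=
    Module.compHom R (CompleteGroupAlgebra.augmentation R G)
  { carrier := R
    continuousSMul := ⟨((CompleteGroupAlgebra.continuous_augmentation R G).comp
      continuous_fst).mul continuous_snd⟩ }

end ProfiniteModule

/-- The profinite group `G` is of type `FP_n` over the profinite commutative ring `R`, `n ≤ ∞`: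
the `R⟦G⟧`-module `R` with trivial `G`-action is of type `FP_n`. -/
def IsGroupFP (R : Type v) [CommRing R] [TopologicalSpace R] [IsTopologicalRing R]
    [CompactSpace R] [T2Space R] [TotallyDisconnectedSpace R]
    (G : Type u) [Group G] [TopologicalSpace G] [IsTopologicalGroup G] [CompactSpace G]
    [T2Space G] [TotallyDisconnectedSpace G] (n : ℕ∞) : Prop :=
  (ProfiniteModule.trivial R G).IsFP n

/-- An open subgroup of a compact group is compact. -/
instance OpenSubgroup.instCompactSpaceToSubgroup {G : Type u} [Group G] [TopologicalSpace G]
    [IsTopologicalGroup G] [CompactSpace G] (H : OpenSubgroup G) : CompactSpace H.toSubgroup :=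
  isCompact_iff_compactSpace.mp H.isClosed.isCompact

/-! Write `Γ` for the complete group algebra of `H` and `Λ` for that of `G`. Representatives `t i`
of the finitely many left cosets of `H`, their inverses, and the map `Λ → Γ` killing the elements of
`G` outside `H` make `Γ → Λ` a Frobenius extension (`frobeniusExtension`). Hence induction from `Γ`
to `Λ` is both left and right adjoint to restriction, and both functors preserve projectivity and
finite generation. Everything except the last part is formal in such an extension.

From `G` to `H`, a resolution is simply restricted (`res_isFP`). Conversely, inducing a resolution
`Q` of the restriction of `M` would resolve the wrong module. Instead `M` is covered by the module
induced from `Q 0` alone, and one passes to the kernel `K` of this cover. A Schanuel-type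
construction (`exists_kerResolution`) resolves the restriction of `K`, with degree `i` finitely
generated as soon as `Q 0` and `Q (i + 1)` are. Iterating and splicing the covers yields a
resolution of `M`; it does not depend on `n`, so `n = ∞` needs no separate argument (`isFP_of_res`).

A finite `G` is discrete, so its trivial subgroup is open. The complete group algebra of the trivial
group is `R`, which resolves itself, and the first statement transfers this to `G`. -/

namespace ProfiniteModule

/-! ### Kernels, direct sums and lifting properties of profinite modules -/

section Constructions

variable {Λ : Type u} [Ring Λ] [TopologicalSpace Λ]

/-- The direct sum of two profinite modules. -/
def prod (M N : ProfiniteModule.{u, w} Λ) : ProfiniteModule.{u, w} Λ where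
  carrier := M × N

/-- The kernel of a continuous homomorphism of profinite modules. -/
def ker {M : ProfiniteModule.{u, w} Λ} {N : ProfiniteModule.{u, v} Λ} (f : M →L[Λ] N) :
    ProfiniteModule.{u, w} Λ :=
  { carrier := f.toLinearMap.ker
    compactSpace := isCompact_iff_compactSpace.mp (f.isClosed_ker.isCompact) }

/-- The inclusion of the kernel. -/
def kerSubtype {M : ProfiniteModule.{u, w} Λ} {N : ProfiniteModule.{u, v} Λ} (f : M →L[Λ] N) :
    ker f →L[Λ] M :=
  f.toLinearMap.ker.subtypeL

theorem kerSubtype_injective {M : ProfiniteModule.{u, w} Λ} {N : ProfiniteModule.{u, v} Λ}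
    (f : M →L[Λ] N) : Function.Injective (kerSubtype f) :=
  Subtype.val_injective

theorem exact_kerSubtype {M : ProfiniteModule.{u, w} Λ} {N : ProfiniteModule.{u, v} Λ}
    (f : M →L[Λ] N) : Function.Exact (kerSubtype f) f := fun m =>
  ⟨fun h => ⟨⟨m, h⟩, rfl⟩, by rintro ⟨k, rfl⟩; exact k.2⟩

theorem exact_kerSubtype_comp {L M : ProfiniteModule.{u, w} Λ} {N : ProfiniteModule.{u, v} Λ}
    (f : M →L[Λ] N) (g : L →L[Λ] ker f) (hg : Function.Surjective g) :
    Function.Exact ((kerSubtype f).comp g) f := fun m => by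
  rw [exact_kerSubtype f m]
  constructor
  · rintro ⟨k, rfl⟩
    obtain ⟨l, rfl⟩ := hg k
    exact ⟨l, rfl⟩
  · rintro ⟨l, rfl⟩
    exact ⟨g l, rfl⟩

/-- The splicing step: covers of successive kernels compose to an exact sequence, since including
`ker k` changes neither the kernel of `f` nor the image of `g`. -/
theorem exact_kerSubtype_comp_kerSubtype_comp {L M K : ProfiniteModule.{u, w} Λ}
    {N : ProfiniteModule.{u, v} Λ} (k : K →L[Λ] N) (f : M →L[Λ] ker k) (g : L →L[Λ] ker f)
    (hg : Function.Surjective g) :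
    Function.Exact ((kerSubtype f).comp g) ((kerSubtype k).comp f) := fun m => by
  rw [← exact_kerSubtype_comp f g hg m]
  exact map_eq_zero_iff _ (kerSubtype_injective k)

/-- Corestriction of a continuous homomorphism to the kernel of another one. -/
def kerLift {L : ProfiniteModule.{u, w} Λ} {M : ProfiniteModule.{u, w} Λ}
    {N : ProfiniteModule.{u, v} Λ} (f : M →L[Λ] N) (g : L →L[Λ] M) (h : ∀ x, f (g x) = 0) :
    L →L[Λ] ker f :=
  g.codRestrict f.toLinearMap.ker h

theorem isFinitelyGenerated_of_finite {M : ProfiniteModule.{u, w} Λ}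
    (h : ∃ S : Set M, S.Finite ∧ Dense (Submodule.span Λ S : Set M)) : M.IsFinitelyGenerated := by
  obtain ⟨S, hS, hd⟩ := h
  exact ⟨hS.toFinset, by rwa [hS.coe_toFinset]⟩

theorem IsFinitelyGenerated.prod {M N : ProfiniteModule.{u, w} Λ}
    (hM : M.IsFinitelyGenerated) (hN : N.IsFinitelyGenerated) :
    (M.prod N).IsFinitelyGenerated := by
  obtain ⟨S, hS⟩ := hM
  obtain ⟨T, hT⟩ := hN
  have key : ∃ X : Set (M × N), X.Finite ∧ Dense (Submodule.span Λ X : Set (M × N)) := by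
    refine ⟨LinearMap.inl Λ M N '' S ∪ LinearMap.inr Λ M N '' T,
      (S.finite_toSet.image _).union (T.finite_toSet.image _), (hS.prod hT).mono ?_⟩
    rintro ⟨m, n⟩ ⟨hm, hn⟩
    rw [SetLike.mem_coe, Submodule.span_union, Submodule.span_image, Submodule.span_image,
      show (m, n) = LinearMap.inl Λ M N m + LinearMap.inr Λ M N n by simp]
    exact Submodule.add_mem_sup (Submodule.mem_map_of_mem hm) (Submodule.mem_map_of_mem hn)
  exact isFinitelyGenerated_of_finite key

/-- Homomorphisms from a projective module lift along surjections, also when the target lives in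
another universe. -/
theorem IsProjective.exists_lift_of_surjective {P A : ProfiniteModule.{u, max u w} Λ}
    (hP : IsProjective.{u, w} P) {B : ProfiniteModule.{u, v} Λ} (f : A →L[Λ] B) (g : P →L[Λ] B)
    (hf : Function.Surjective f) : ∃ h : P →L[Λ] A, ∀ x, f (h x) = g x := by
  -- The kernel of `δ` is the pullback of `f` and `g`. It lies in the universe allowed by
  -- `IsProjective`, so the identity of `P` can be lifted along it and projected to `A`.
  let δ : P.prod A →L[Λ] B := (g.coprod (-f) : P × A →L[Λ] B)
  let p₁ : P.prod A →L[Λ] P := (ContinuousLinearMap.fst Λ P A : P × A →L[Λ] P)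
  let p₂ : P.prod A →L[Λ] A := (ContinuousLinearMap.snd Λ P A : P × A →L[Λ] A)
  have hδ : ∀ x, δ x = g (p₁ x) - f (p₂ x) := fun x => (sub_eq_add_neg _ _).symm
  obtain ⟨h, hh⟩ := hP (ker δ) P (p₁.comp (kerSubtype δ)) (ContinuousLinearMap.id Λ P) (by
    intro p
    obtain ⟨a, ha⟩ := hf (g p)
    exact ⟨⟨(p, a), (hδ (p, a)).trans (sub_eq_zero.2 ha.symm)⟩, rfl⟩)
  refine ⟨(p₂.comp (kerSubtype δ)).comp h, fun x => ?_⟩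
  have h₁ : p₁ (kerSubtype δ (h x)) = x := DFunLike.congr_fun hh x
  have h₂ : δ (kerSubtype δ (h x)) = 0 := (h x).2
  rw [hδ, h₁, sub_eq_zero] at h₂
  exact h₂.symm

/-- Homomorphisms from a projective module lift along the left map of an exact sequence. -/
theorem IsProjective.exists_lift_of_exact {P A B : ProfiniteModule.{u, max u w} Λ}
    (hP : IsProjective.{u, w} P) {C : ProfiniteModule.{u, v} Λ}
    (f : A →L[Λ] B) (k : B →L[Λ] C) (hfk : Function.Exact f k) (g : P →L[Λ] B)
    (hg : ∀ x, k (g x) = 0) : ∃ h : P →L[Λ] A, ∀ x, f (h x) = g x := by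
  obtain ⟨h, hh⟩ := hP.exists_lift_of_surjective
    (kerLift k f fun x => hfk.apply_apply_eq_zero x) (kerLift k g hg) (by
      intro b
      obtain ⟨a, ha⟩ := (hfk (kerSubtype k b)).1 b.2
      exact ⟨a, kerSubtype_injective k ha⟩)
  exact ⟨h, fun x => congrArg (kerSubtype k) (hh x)⟩

theorem IsProjective.prod {P Q : ProfiniteModule.{u, max u w} Λ}
    (hP : IsProjective.{u, w} P) (hQ : IsProjective.{u, w} Q) :
    IsProjective.{u, w} (P.prod Q) := by
  intro A B f g hf
  obtain ⟨h₁, hh₁⟩ := hP A B f (g.comp (ContinuousLinearMap.inl Λ P Q)) hf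
  obtain ⟨h₂, hh₂⟩ := hQ A B f (g.comp (ContinuousLinearMap.inr Λ P Q)) hf
  refine ⟨(ContinuousLinearMap.coprod h₁ h₂ : P × Q →L[Λ] A), ?_⟩
  ext ⟨p, q⟩
  have e₁ := DFunLike.congr_fun hh₁ p
  have e₂ := DFunLike.congr_fun hh₂ q
  change f (h₁ p + h₂ q) = _
  rw [map_add]
  change f (h₁ p) = g (p, 0) at e₁
  change f (h₂ q) = g (0, q) at e₂
  rw [e₁, e₂]
  exact (map_add g (p, 0) (0, q)).symm.trans (congrArg g (by
    change (p + 0, 0 + q) = (p, q); simp))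

end Constructions
end ProfiniteModule

/-! ### Resolving the kernel of a projective cover -/

namespace ProfiniteModule

section Resolutions

variable {Λ : Type u} [Ring Λ] [TopologicalSpace Λ]

/-- Resolutions transport along bijective continuous homomorphisms. -/
def ProjectiveResolution.ofBijective {M : ProfiniteModule.{u, w} Λ} {N : ProfiniteModule.{u, w} Λ}
    (Q : ProjectiveResolution M) (f : M →L[Λ] N) (hf : Function.Bijective f) :
    ProjectiveResolution N where
  X := Q.X
  d := Q.d
  ε := f.comp Q.ε
  projective := Q.projective
  surjective_ε := hf.2.comp Q.surjective_ε
  exact_zero x := by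
    rw [← Q.exact_zero x]
    exact map_eq_zero_iff f hf.1
  exact_succ := Q.exact_succ

theorem IsFP.of_bijective {M : ProfiniteModule.{u, w} Λ} {N : ProfiniteModule.{u, w} Λ} {n : ℕ∞}
    (h : M.IsFP n) (f : M →L[Λ] N) (hf : Function.Bijective f) : N.IsFP n := by
  obtain ⟨Q, hQ⟩ := h
  exact ⟨Q.ofBijective f hf, hQ⟩

variable {M : ProfiniteModule.{u, w} Λ}

/-- If `P → M` is a surjection from a projective module and `Q` is a projective resolution of `M`,
these are the terms of a projective resolution of the kernel of `P → M`. -/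
def kerResolutionX (Q : ProjectiveResolution.{u, w} M) (P : ProfiniteModule.{u, max u w} Λ) :
    ℕ → ProfiniteModule.{u, max u w} Λ
  | 0 => (Q.X 1).prod P
  | 1 => (Q.X 2).prod (Q.X 0)
  | i + 2 => Q.X (i + 3)

theorem kerResolutionX_isFinitelyGenerated (Q : ProjectiveResolution.{u, w} M)
    (P : ProfiniteModule.{u, max u w} Λ) (i : ℕ) (hP : P.IsFinitelyGenerated)
    (h₀ : (Q.X 0).IsFinitelyGenerated) (hi : (Q.X (i + 1)).IsFinitelyGenerated) :
    (kerResolutionX Q P i).IsFinitelyGenerated :=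
  match i with
  | 0 => hi.prod hP
  | 1 => hi.prod h₀
  | _ + 2 => hi

theorem kerResolutionX_isProjective (Q : ProjectiveResolution.{u, w} M)
    (P : ProfiniteModule.{u, max u w} Λ) (hP : IsProjective.{u, w} P) :
    ∀ i, IsProjective.{u, w} (kerResolutionX Q P i)
  | 0 => (Q.projective 1).prod hP
  | 1 => (Q.projective 2).prod (Q.projective 0)
  | i + 2 => Q.projective (i + 3)

/-- The differentials of `kerResolution`. -/
def kerResolutionD (Q : ProjectiveResolution.{u, w} M) (P : ProfiniteModule.{u, max u w} Λ)
    (t : Q.X 0 →L[Λ] P) (r : Q.X 0 →L[Λ] Q.X 1) :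
    ∀ i, kerResolutionX Q P (i + 1) →L[Λ] kerResolutionX Q P i
  | 0 => (((Q.d 1).coprod r).prod (t.comp (ContinuousLinearMap.snd Λ (Q.X 2) (Q.X 0))) :
      Q.X 2 × Q.X 0 →L[Λ] Q.X 1 × P)
  | 1 => ((ContinuousLinearMap.inl Λ (Q.X 2) (Q.X 0)).comp (Q.d 2) : Q.X 3 →L[Λ] Q.X 2 × Q.X 0)
  | i + 2 => Q.d (i + 3)

/-- Let `s : P → Q 0` lift `μ`. The map `(q, p) ↦ s p - d q` from `Q 1 × P` to `Q 0` is onto, and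
its kernel `Z` maps onto `ker μ` by `(q, p) ↦ p`, so `⋯ → Q 3 → Q 2 → Z → ker μ` is exact. Adding a
copy of `Q 0` in degrees 0 and 1 replaces `Z` by `Q 1 × P`, so no direct summand has to be
discussed. -/
theorem exists_kerResolution (Q : ProjectiveResolution.{u, w} M)
    (P : ProfiniteModule.{u, max u w} Λ) (hP : IsProjective.{u, w} P) (μ : P →L[Λ] M)
    (hμ : Function.Surjective μ) :
    ∃ Q' : ProjectiveResolution.{u, max u w} (ker μ), Q'.X = kerResolutionX Q P := by
  obtain ⟨s, hs⟩ := hP.exists_lift_of_surjective Q.ε μ Q.surjective_ε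
  obtain ⟨t, ht⟩ := (Q.projective 0).exists_lift_of_surjective μ Q.ε hμ
  -- `r` is a homotopy from the identity to `s ∘ t` in degree 0; it makes `x ↦ (r x, t x)` a section
  -- of `(q, p) ↦ s p - d q`.
  obtain ⟨r, hr⟩ := (Q.projective 0).exists_lift_of_exact (Q.d 0) Q.ε Q.exact_zero
    (s.comp t - ContinuousLinearMap.id Λ (Q.X 0)) (by
      intro x
      change Q.ε (s (t x) - x) = 0
      rw [map_sub, hs, ht, sub_self])
  have hr' : ∀ x, Q.d 0 (r x) = s (t x) - x := hr
  have hε : ∀ x, Q.ε (Q.d 0 x) = 0 := Q.exact_zero.apply_apply_eq_zero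
  have hd : ∀ i x, Q.d i (Q.d (i + 1) x) = 0 := fun i => (Q.exact_succ i).apply_apply_eq_zero
  -- `e (q, p) = p - t (s p - d q)` is the `P`-coordinate of the projector onto `Z` along this
  -- section.
  let e : (Q.X 1).prod P →L[Λ] P :=
    ((t.comp (Q.d 0)).coprod (ContinuousLinearMap.id Λ P - t.comp s) : Q.X 1 × P →L[Λ] P)
  have he : ∀ q p, e (q, p) = t (Q.d 0 q) + (p - t (s p)) := fun _ _ => rfl
  have hμe : ∀ x, μ (e x) = 0 := by
    rintro ⟨q, p⟩
    rw [he, map_add, map_sub, ht, ht, hs, hε, sub_self, add_zero]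
  have hs0 : ∀ k, μ k = 0 → ∃ q, Q.d 0 q = s k := fun k hk =>
    (Q.exact_zero (s k)).1 (by rw [hs, hk])
  have hd₀ : ∀ y x, kerResolutionD Q P t r 0 (y, x) = (Q.d 1 y + r x, t x) := fun _ _ => rfl
  have hd₁ : ∀ y, kerResolutionD Q P t r 1 y = (Q.d 2 y, 0) := fun _ => rfl
  refine ⟨⟨kerResolutionX Q P, kerResolutionD Q P t r, kerLift μ e hμe,
    kerResolutionX_isProjective Q P hP, ?_, ?_, ?_⟩, rfl⟩
  · intro k
    obtain ⟨q, hq⟩ := hs0 (kerSubtype μ k) k.2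
    refine ⟨(q, kerSubtype μ k), kerSubtype_injective μ ?_⟩
    change t (Q.d 0 q) + (kerSubtype μ k - t (s (kerSubtype μ k))) = kerSubtype μ k
    rw [hq]
    abel
  · rintro ⟨q, p⟩
    refine (kerSubtype_injective μ).eq_iff.symm.trans ?_
    change t (Q.d 0 q) + (p - t (s p)) = 0 ↔ _
    constructor
    · intro h
      -- The element `x = s p - d q` is the only candidate for the `Q 0`-coordinate of a preimage;
      -- subtracting `r x` from `q` leaves a cycle of `Q`.
      have hp : p = t (s p - Q.d 0 q) := by
        rw [map_sub, ← sub_eq_zero, ← h]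
        abel
      set x := s p - Q.d 0 q with hx
      have hsx : Q.d 0 (q - r x) = 0 := by
        rw [map_sub, hr', ← hp, hx]
        abel
      obtain ⟨y, hy⟩ := (Q.exact_succ 0 _).1 hsx
      refine ⟨(y, x), ?_⟩
      rw [hd₀, ← hp]
      exact congrArg (·, p) (by rw [hy]; abel)
    · rintro ⟨⟨y, x⟩, h⟩
      rw [hd₀] at h
      obtain ⟨rfl, rfl⟩ := Prod.mk.inj h
      rw [map_add, hd, hr', zero_add, map_sub]
      abel
  · rintro (_ | i)
    · rintro ⟨y, x⟩
      rw [hd₀]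
      constructor
      · intro h
        obtain ⟨h₁, h₂⟩ := Prod.mk.inj h
        have hx : x = 0 := by
          have := congrArg (Q.d 0) h₁
          rwa [map_add, hd, hr', h₂, map_zero, map_zero, zero_add, zero_sub, neg_eq_zero] at this
        subst hx
        rw [map_zero, add_zero] at h₁
        obtain ⟨z, rfl⟩ := (Q.exact_succ 1 _).1 h₁
        exact ⟨z, rfl⟩
      · rintro ⟨z, h⟩
        rw [hd₁] at h
        obtain ⟨rfl, rfl⟩ := Prod.mk.inj h
        have : Q.d 1 (Q.d 2 z) = 0 := hd 1 z
        rw [this, map_zero, map_zero, add_zero]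
        rfl
    · rcases i with _ | i
      · intro y
        rw [hd₁]
        refine Iff.trans ?_ (Q.exact_succ 2 y)
        exact ⟨fun h => (Prod.mk.inj h).1, fun h => congrArg (·, _) h⟩
      · exact Q.exact_succ (i + 3)

end Resolutions
end ProfiniteModule

/-! ### Frobenius extensions, restriction and induction -/

/-- A topological Frobenius extension `Γ → Λ`: a continuous ring homomorphism together with a
continuous homomorphism of bimodules `Λ → Γ` and a finite pair of dual bases, indexed by `I`. -/
structure FrobeniusExtension (Γ Λ : Type u) [Ring Γ] [TopologicalSpace Γ] [Ring Λ]
    [TopologicalSpace Λ] (I : Type) [Fintype I] [DecidableEq I] where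
  incl : Γ →+* Λ
  continuous_incl : Continuous incl
  proj : Λ →+ Γ
  continuous_proj : Continuous proj
  proj_incl_mul : ∀ a x, proj (incl a * x) = a * proj x
  proj_mul_incl : ∀ x a, proj (x * incl a) = proj x * a
  basis : I → Λ
  dual : I → Λ
  sum_proj_mul_dual : ∀ x, ∑ i, incl (proj (x * basis i)) * dual i = x
  sum_basis_mul_proj : ∀ x, ∑ i, basis i * incl (proj (dual i * x)) = x
  proj_dual_mul_basis : ∀ i j, proj (dual i * basis j) = if i = j then 1 else 0

namespace ProfiniteModule

section Restriction

variable {Γ Λ : Type u} [Ring Γ] [TopologicalSpace Γ] [Ring Λ] [TopologicalSpace Λ]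

/-- Restriction of scalars along a continuous ring homomorphism. -/
def restrict (φ : Γ →+* Λ) (hφ : Continuous φ) (M : ProfiniteModule.{u, w} Λ) :
    ProfiniteModule.{u, w} Γ :=
  letI : Module Γ M := Module.compHom M φ
  { carrier := M
    continuousSMul := ⟨(hφ.comp continuous_fst).smul continuous_snd⟩ }

variable {φ : Γ →+* Λ} {hφ : Continuous φ}

/-- Restriction of scalars on homomorphisms. -/
def restrictMap {M : ProfiniteModule.{u, w} Λ} {N : ProfiniteModule.{u, v} Λ} (f : M →L[Λ] N) :
    M.restrict φ hφ →L[Γ] N.restrict φ hφ where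
  toFun := f
  map_add' := map_add f
  map_smul' a x := f.map_smul' (φ a) x
  cont := f.continuous

/-- A homomorphism of restrictions of modules, as a homomorphism of underlying groups. -/
def restrictHom {Q : ProfiniteModule.{u, w} Γ} {M : ProfiniteModule.{u, v} Λ}
    (f : Q →L[Γ] M.restrict φ hφ) : Q →+ M where
  toFun := f
  map_zero' := map_zero f
  map_add' := map_add f

theorem restrictHom_smul {Q : ProfiniteModule.{u, w} Γ} {M : ProfiniteModule.{u, v} Λ}
    (f : Q →L[Γ] M.restrict φ hφ) (a : Γ) (x : Q) :
    restrictHom f (a • x) = φ a • restrictHom f x :=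
  f.map_smul' a x

theorem continuous_restrictHom {Q : ProfiniteModule.{u, w} Γ} {M : ProfiniteModule.{u, v} Λ}
    (f : Q →L[Γ] M.restrict φ hφ) : Continuous (restrictHom f) :=
  f.continuous

/-- A homomorphism from the restriction of a module, as a homomorphism of underlying groups. -/
def ofRestrictHom {Q : ProfiniteModule.{u, w} Γ} {M : ProfiniteModule.{u, v} Λ}
    (f : M.restrict φ hφ →L[Γ] Q) : M →+ Q where
  toFun := f
  map_zero' := map_zero f
  map_add' := map_add f

theorem ofRestrictHom_smul {Q : ProfiniteModule.{u, w} Γ} {M : ProfiniteModule.{u, v} Λ}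
    (f : M.restrict φ hφ →L[Γ] Q) (a : Γ) (x : M) :
    ofRestrictHom f (φ a • x) = a • ofRestrictHom f x :=
  f.map_smul' a x

theorem continuous_ofRestrictHom {Q : ProfiniteModule.{u, w} Γ} {M : ProfiniteModule.{u, v} Λ}
    (f : M.restrict φ hφ →L[Γ] Q) : Continuous (ofRestrictHom f) :=
  f.continuous

end Restriction

end ProfiniteModule

namespace FrobeniusExtension

open ProfiniteModule

variable {Γ Λ : Type u} [Ring Γ] [TopologicalSpace Γ] [Ring Λ] [TopologicalSpace Λ]
  {I : Type} [Fintype I] [DecidableEq I] (F : FrobeniusExtension Γ Λ I)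

/-- Restriction of scalars along a Frobenius extension. -/
abbrev res (M : ProfiniteModule.{u, w} Λ) : ProfiniteModule.{u, w} Γ :=
  M.restrict F.incl F.continuous_incl

/-- Expand `y` in the basis and use right `Γ`-linearity of `proj`. This says that `x ↦ (proj (dual i
* x * basis j))` is multiplicative into matrices, which makes `matrixModule` an action. -/
theorem sum_proj_mul_proj (x y : Λ) :
    ∑ j, F.proj (x * F.basis j) * F.proj (F.dual j * y) = F.proj (x * y) := by
  conv_rhs => rw [← F.sum_basis_mul_proj y, Finset.mul_sum, map_sum]
  exact Finset.sum_congr rfl fun j _ => by rw [← mul_assoc, F.proj_mul_incl]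

theorem sum_proj_smul_dual_smul {M : Type*} [AddCommGroup M] [Module Λ M] (x : Λ) (m : M) :
    ∑ i, F.incl (F.proj (x * F.basis i)) • F.dual i • m = x • m := by
  simp_rw [smul_smul, ← Finset.sum_smul, F.sum_proj_mul_dual]

theorem sum_basis_smul_proj_smul {M : Type*} [AddCommGroup M] [Module Λ M] (x : Λ) (m : M) :
    ∑ i, F.basis i • F.incl (F.proj (F.dual i * x)) • m = x • m := by
  simp_rw [smul_smul, ← Finset.sum_smul, F.sum_basis_mul_proj]

/-- The matrix action of `Λ` on `Q^I`, where `Λ` is regarded as a ring of matrices over `Γ`. -/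
abbrev matrixModule (Q : Type*) [AddCommGroup Q] [Module Γ Q] : Module Λ (I → Q) where
  smul x v := fun i => ∑ j, F.proj (F.dual i * x * F.basis j) • v j
  one_smul v := funext fun i => by
    change ∑ j, F.proj (F.dual i * 1 * F.basis j) • v j = v i
    simp_rw [mul_one, F.proj_dual_mul_basis, ite_smul, one_smul, zero_smul]
    simp
  mul_smul x y v := funext fun i => by
    change ∑ k, F.proj (F.dual i * (x * y) * F.basis k) • v k =
      ∑ j, F.proj (F.dual i * x * F.basis j) • ∑ k, F.proj (F.dual j * y * F.basis k) • v k
    simp_rw [Finset.smul_sum, smul_smul]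
    rw [Finset.sum_comm]
    refine Finset.sum_congr rfl fun k _ => ?_
    rw [← Finset.sum_smul]
    simp_rw [mul_assoc (F.dual _) y, F.sum_proj_mul_proj, mul_assoc]
  smul_zero x := funext fun i => by
    change ∑ j, F.proj (F.dual i * x * F.basis j) • (0 : Q) = 0
    simp
  smul_add x v w := funext fun i => by
    change ∑ j, F.proj (F.dual i * x * F.basis j) • (v j + w j) = _
    simp_rw [smul_add, Finset.sum_add_distrib]
    rfl
  add_smul x y v := funext fun i => by
    change ∑ j, F.proj (F.dual i * (x + y) * F.basis j) • v j = _
    simp_rw [mul_add, add_mul, map_add, add_smul, Finset.sum_add_distrib]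
    rfl
  zero_smul v := funext fun i => by
    change ∑ j, F.proj (F.dual i * 0 * F.basis j) • v j = 0
    simp

variable [IsTopologicalRing Λ]

/-- The induced module, which is both left and right adjoint to restriction. -/
def induce (Q : ProfiniteModule.{u, w} Γ) : ProfiniteModule.{u, w} Λ :=
  letI : Module Λ (I → Q) := F.matrixModule Q
  { carrier := I → Q
    continuousSMul := ⟨continuous_pi fun i => by
      change Continuous fun p : Λ × (I → Q) =>
        ∑ j, F.proj (F.dual i * p.1 * F.basis j) • p.2 j
      have := F.continuous_proj
      exact continuous_finsetSum _ fun j _ => (this.comp (by fun_prop)).smul (by fun_prop)⟩ }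

@[ext]
theorem induce_ext {Q : ProfiniteModule.{u, w} Γ} {v v' : F.induce Q}
    (h : ∀ i, (v i : Q) = v' i) : v = v' :=
  funext h

/-- Induction on homomorphisms. -/
def induceMap {Q Q' : ProfiniteModule.{u, w} Γ} (f : Q →L[Γ] Q') :
    F.induce Q →L[Λ] F.induce Q' where
  toFun v := fun i => f (v i)
  map_add' v v' := funext fun i => map_add f (v i) (v' i)
  map_smul' x v := F.induce_ext fun i => by
    change f (∑ j, F.proj (F.dual i * x * F.basis j) • (v j : Q)) =
      ∑ j, F.proj (F.dual i * x * F.basis j) • f (v j)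
    rw [map_sum]
    exact Finset.sum_congr rfl fun j _ => map_smul f _ _
  cont := continuous_pi fun i => f.continuous.comp (continuous_apply i)

/-- The unit of the adjunction between induction and restriction. -/
def unit (Q : ProfiniteModule.{u, w} Γ) : Q →L[Γ] F.res (F.induce Q) where
  toFun q := fun i => F.proj (F.dual i) • q
  map_add' q q' := funext fun i => smul_add (F.proj (F.dual i)) q q'
  map_smul' a q := F.induce_ext fun i => by
    change F.proj (F.dual i) • a • q =
      ∑ j, F.proj (F.dual i * F.incl a * F.basis j) • F.proj (F.dual j) • q
    simp_rw [smul_smul, ← Finset.sum_smul]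
    have := F.sum_proj_mul_proj (F.dual i * F.incl a) 1
    simp_rw [mul_one, F.proj_mul_incl] at this
    rw [this]
  cont := continuous_pi fun i => continuous_const_smul (F.proj (F.dual i))

/-- By duality of the two bases, `basis i • unit q` is the vector with `q` in coordinate `i` and
zero elsewhere. So the image of the unit generates the induced module over `Λ`. -/
theorem sum_basis_smul_unit {Q : ProfiniteModule.{u, w} Γ} (v : F.induce Q) :
    ∑ i, F.basis i • restrictHom (F.unit Q) (v i) = v := by
  refine F.induce_ext fun k => ?_
  refine (Finset.sum_apply k _ _).trans ?_
  change ∑ i, ∑ j, F.proj (F.dual k * F.basis i * F.basis j) • F.proj (F.dual j) • (v i : Q) = v k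
  simp_rw [smul_smul, ← Finset.sum_smul]
  have : ∀ i, ∑ j, F.proj (F.dual k * F.basis i * F.basis j) * F.proj (F.dual j) =
      if k = i then 1 else 0 := fun i => by
    have := F.sum_proj_mul_proj (F.dual k * F.basis i) 1
    simp_rw [mul_one] at this
    rw [this, F.proj_dual_mul_basis]
  simp_rw [this, ite_smul, one_smul, zero_smul]
  exact (Finset.sum_ite_eq Finset.univ k (v : I → Q)).trans (if_pos (Finset.mem_univ k))

/-- The homomorphism from an induced module corresponding to a homomorphism to a restriction. -/
def induceLift {Q : ProfiniteModule.{u, w} Γ} {M : ProfiniteModule.{u, v} Λ}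
    (f : Q →L[Γ] F.res M) : F.induce Q →L[Λ] M where
  toFun v := ∑ i, F.basis i • restrictHom f (v i)
  map_add' v v' := by
    rw [← Finset.sum_add_distrib]
    refine Finset.sum_congr rfl fun i _ => ?_
    rw [← smul_add, ← map_add]
    rfl
  map_smul' x v := by
    change ∑ i, F.basis i • restrictHom f (∑ j, F.proj (F.dual i * x * F.basis j) • (v j : Q)) =
      x • ∑ j, F.basis j • restrictHom f (v j)
    simp_rw [map_sum, restrictHom_smul, Finset.smul_sum]
    rw [Finset.sum_comm]
    refine Finset.sum_congr rfl fun j _ => ?_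
    simp_rw [mul_assoc, F.sum_basis_smul_proj_smul, smul_smul]
  cont := continuous_finsetSum _ fun i _ =>
    ((continuous_restrictHom f).comp (continuous_apply i)).const_smul _

theorem induceLift_apply {Q : ProfiniteModule.{u, w} Γ} {M : ProfiniteModule.{u, v} Λ}
    (f : Q →L[Γ] F.res M) (v : F.induce Q) :
    F.induceLift f v = ∑ i, F.basis i • restrictHom f (v i) :=
  rfl

theorem induceLift_unit {Q : ProfiniteModule.{u, w} Γ} {M : ProfiniteModule.{u, v} Λ}
    (f : Q →L[Γ] F.res M) (q : Q) : F.induceLift f (restrictHom (F.unit Q) q) = f q := by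
  change ∑ i, F.basis i • restrictHom f (F.proj (F.dual i) • q) = restrictHom f q
  have := F.sum_basis_smul_proj_smul 1 (restrictHom f q)
  simp_rw [mul_one, one_smul] at this
  simp_rw [restrictHom_smul, this]

theorem induceLift_surjective {Q : ProfiniteModule.{u, w} Γ} {M : ProfiniteModule.{u, v} Λ}
    (f : Q →L[Γ] F.res M) (hf : Function.Surjective f) : Function.Surjective (F.induceLift f) :=
  fun m => by
    obtain ⟨q, hq⟩ := hf m
    exact ⟨_, (F.induceLift_unit f q).trans hq⟩

/-- The counit of the adjunction between restriction and induction. -/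
def counit (Q : ProfiniteModule.{u, w} Γ) : F.res (F.induce Q) →L[Γ] Q where
  toFun v := ∑ i, F.proj (F.basis i) • (show F.induce Q from v) i
  map_add' v v' := by
    rw [← Finset.sum_add_distrib]
    exact Finset.sum_congr rfl fun i _ => smul_add (F.proj (F.basis i)) (_ : Q) _
  map_smul' a v := by
    change ∑ i, F.proj (F.basis i) •
        ∑ j, F.proj (F.dual i * F.incl a * F.basis j) • ((show F.induce Q from v) j : Q) =
      a • ∑ j, F.proj (F.basis j) • ((show F.induce Q from v) j : Q)
    simp_rw [Finset.smul_sum, smul_smul]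
    rw [Finset.sum_comm]
    refine Finset.sum_congr rfl fun j _ => ?_
    rw [← Finset.sum_smul]
    have := F.sum_proj_mul_proj 1 (F.incl a * F.basis j)
    simp_rw [one_mul, ← mul_assoc] at this
    rw [this, F.proj_incl_mul]
  cont := continuous_finsetSum _ fun i _ =>
    (continuous_apply (A := fun _ : I => Q) i).const_smul (F.proj (F.basis i))

theorem counit_induceMap {Q Q' : ProfiniteModule.{u, w} Γ} (f : Q →L[Γ] Q') (v : F.induce Q) :
    F.counit Q' (F.induceMap f v) = f (F.counit Q v) := by
  change ∑ i, F.proj (F.basis i) • f (v i) = f (∑ i, F.proj (F.basis i) • (v i : Q))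
  rw [map_sum]
  exact Finset.sum_congr rfl fun i _ => (map_smul f _ _).symm

/-- The homomorphism to an induced module corresponding to a homomorphism from a restriction. -/
def induceColift {Q : ProfiniteModule.{u, w} Γ} {M : ProfiniteModule.{u, v} Λ}
    (f : F.res M →L[Γ] Q) : M →L[Λ] F.induce Q where
  toFun m := fun i => ofRestrictHom f (F.dual i • m)
  map_add' m m' := funext fun i => by rw [smul_add, map_add]; rfl
  map_smul' x m := F.induce_ext fun i => by
    change ofRestrictHom f (F.dual i • x • m) =
      ∑ j, F.proj (F.dual i * x * F.basis j) • ofRestrictHom f (F.dual j • m)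
    simp_rw [← ofRestrictHom_smul, ← map_sum, F.sum_proj_smul_dual_smul, smul_smul]
  cont := continuous_pi fun i => (continuous_ofRestrictHom f).comp (continuous_const_smul _)

theorem counit_induceColift {Q : ProfiniteModule.{u, w} Γ} {M : ProfiniteModule.{u, v} Λ}
    (f : F.res M →L[Γ] Q) (m : M) : F.counit Q (F.induceColift f m) = f m := by
  change ∑ i, F.proj (F.basis i) • ofRestrictHom f (F.dual i • m) = ofRestrictHom f m
  have := F.sum_proj_smul_dual_smul 1 m
  simp_rw [one_mul, one_smul] at this
  simp_rw [← ofRestrictHom_smul, ← map_sum, this]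

end FrobeniusExtension

/-! ### Finiteness and projectivity under restriction and induction -/

namespace FrobeniusExtension

open ProfiniteModule

variable {Γ Λ : Type u} [Ring Γ] [TopologicalSpace Γ] [Ring Λ] [TopologicalSpace Λ]
  {I : Type} [Fintype I] [DecidableEq I] (F : FrobeniusExtension Γ Λ I)

theorem span_le_span_res {M : ProfiniteModule.{u, w} Λ} (S : Set M) (m : M)
    (hm : m ∈ Submodule.span Λ S) :
    (show F.res M from m) ∈
      Submodule.span Γ (⋃ i, (fun m : M => F.dual i • m) '' S : Set (F.res M)) := by
  have hS : ∀ (x : Λ) (m : M), m ∈ S → (show F.res M from x • m) ∈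
      Submodule.span Γ (⋃ i, (fun m : M => F.dual i • m) '' S : Set (F.res M)) := by
    intro x m hm
    rw [← F.sum_proj_smul_dual_smul x m]
    refine Submodule.sum_mem (M := F.res M) _ fun i _ => ?_
    exact Submodule.smul_mem (M := F.res M) _ (F.proj (x * F.basis i))
      (Submodule.subset_span (Set.mem_iUnion.2 ⟨i, m, hm, rfl⟩))
  -- Only sums of multiples `x • m` with `m ∈ S` need treatment, so stability of the `Γ`-span under
  -- `Λ` is not required.
  induction hm using Submodule.closure_induction with
  | zero => exact Submodule.zero_mem (M := F.res M) _
  | add x y _ _ hx hy => exact Submodule.add_mem (M := F.res M) _ hx hy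
  | smul_mem x m hm => exact hS x m hm

theorem res_isFinitelyGenerated {M : ProfiniteModule.{u, w} Λ} (hM : M.IsFinitelyGenerated) :
    (F.res M).IsFinitelyGenerated := by
  obtain ⟨S, hS⟩ := hM
  refine isFinitelyGenerated_of_finite ⟨⋃ i, (fun m : M => F.dual i • m) '' S,
    Set.finite_iUnion fun i => S.finite_toSet.image _, ?_⟩
  exact Dense.mono (F.span_le_span_res (S : Set M)) hS

variable [IsTopologicalRing Λ]

/-- The right adjoint of restriction is induction, which acts coordinatewise and so preserves
surjections: lift the transposed map over `Λ`, then apply the counit. -/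
theorem res_isProjective {P : ProfiniteModule.{u, max u w} Λ} (hP : IsProjective.{u, w} P) :
    IsProjective.{u, w} (F.res P) := by
  intro A B f g hf
  obtain ⟨h, hh⟩ := hP (F.induce A) (F.induce B) (F.induceMap f) (F.induceColift g) (by
    intro v
    choose a ha using hf
    exact ⟨fun i => a (v i), funext fun i => ha _⟩)
  refine ⟨(F.counit A).comp (restrictMap h), ?_⟩
  ext p
  change f (F.counit A (h p)) = g p
  rw [← counit_induceMap, ← F.counit_induceColift g p]
  exact congrArg (F.counit B) (DFunLike.congr_fun hh p)

/-- Here the right adjoint is restriction, which does not alter underlying maps and so preserves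
surjections. -/
theorem induce_isProjective {Q : ProfiniteModule.{u, max u w} Γ} (hQ : IsProjective.{u, w} Q) :
    IsProjective.{u, w} (F.induce Q) := by
  intro A B f g hf
  obtain ⟨h, hh⟩ := hQ (F.res A) (F.res B) (restrictMap f) ((restrictMap g).comp (F.unit Q)) hf
  refine ⟨F.induceLift h, ?_⟩
  ext v
  change f (F.induceLift h v) = g v
  conv_rhs => rw [← F.sum_basis_smul_unit v]
  rw [induceLift_apply, map_sum, map_sum]
  refine Finset.sum_congr rfl fun i _ => ?_
  rw [map_smul, map_smul]
  exact congrArg (F.basis i • ·) (DFunLike.congr_fun hh (v i))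

/-- Topological generators of `Q` map under the unit to topological generators: by continuity the
closure of their `Λ`-span contains the whole image of the unit, which generates. -/
theorem induce_isFinitelyGenerated {Q : ProfiniteModule.{u, w} Γ} (hQ : Q.IsFinitelyGenerated) :
    (F.induce Q).IsFinitelyGenerated := by
  obtain ⟨S, hS⟩ := hQ
  refine isFinitelyGenerated_of_finite ⟨restrictHom (F.unit Q) '' S, S.finite_toSet.image _, ?_⟩
  set N := Submodule.span Λ (restrictHom (F.unit Q) '' (S : Set Q)) with hN
  have h₁ : ∀ q ∈ Submodule.span Γ (S : Set Q), restrictHom (F.unit Q) q ∈ N := by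
    intro q hq
    induction hq using Submodule.span_induction with
    | mem q hq => exact Submodule.subset_span ⟨q, hq, rfl⟩
    | zero => rw [map_zero]; exact N.zero_mem
    | add x y _ _ hx hy => rw [map_add]; exact N.add_mem hx hy
    | smul a x _ hx => rw [restrictHom_smul]; exact N.smul_mem _ hx
  have h₂ : ∀ q, restrictHom (F.unit Q) q ∈ N.topologicalClosure := fun q =>
    map_mem_closure (continuous_restrictHom (F.unit Q)) (hS q) h₁
  intro v
  change v ∈ N.topologicalClosure
  rw [← F.sum_basis_smul_unit v]
  exact sum_mem fun i _ => Submodule.smul_mem _ _ (h₂ _)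

theorem res_isFP {M : ProfiniteModule.{u, w} Λ} {n : ℕ∞} (hM : M.IsFP n) : (F.res M).IsFP n := by
  obtain ⟨P, hP⟩ := hM
  exact ⟨{
    X := fun i => F.res (P.X i)
    d := fun i => restrictMap (P.d i)
    ε := restrictMap P.ε
    projective := fun i => F.res_isProjective.{u, w} (P.projective i)
    surjective_ε := P.surjective_ε
    exact_zero := P.exact_zero
    exact_succ := P.exact_succ }, fun i hi => F.res_isFinitelyGenerated (hP i hi)⟩

/-- The first syzygy of `M` with respect to the cover induced from a resolution of the restriction
of `M`. -/
def syzygy {M : ProfiniteModule.{u, w} Λ} (Q : ProjectiveResolution.{u, w} (F.res M)) :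
    ProfiniteModule.{u, max u w} Λ :=
  ker (F.induceLift Q.ε)

theorem exists_syzygyResolution {M : ProfiniteModule.{u, w} Λ}
    (Q : ProjectiveResolution.{u, w} (F.res M)) :
    ∃ Q' : ProjectiveResolution.{u, max u w} (F.res (F.syzygy Q)),
      ∀ i, (Q.X 0).IsFinitelyGenerated → (Q.X (i + 1)).IsFinitelyGenerated →
        (Q'.X i).IsFinitelyGenerated := by
  have hproj := F.induce_isProjective.{u, w} (Q.projective 0)
  obtain ⟨Q', hQ'⟩ := exists_kerResolution Q (F.res (F.induce (Q.X 0)))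
    (F.res_isProjective.{u, w} hproj) (restrictMap (F.induceLift Q.ε))
    (F.induceLift_surjective Q.ε Q.surjective_ε)
  -- Restricting the kernel and taking the kernel of the restriction give the same underlying
  -- module, so the identity compares them.
  refine ⟨Q'.ofBijective (N := F.res (F.syzygy Q))
    ⟨⟨⟨id, fun _ _ => rfl⟩, fun _ _ => rfl⟩, continuous_id⟩
    Function.bijective_id, fun i h₀ hi => ?_⟩
  change (Q'.X i).IsFinitelyGenerated
  rw [hQ']
  exact kerResolutionX_isFinitelyGenerated Q _ i
    (F.res_isFinitelyGenerated (F.induce_isFinitelyGenerated h₀)) h₀ hi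

/-- A resolution of the restriction of `F.syzygy Q`, with good finiteness properties. -/
noncomputable def syzygyResolution {M : ProfiniteModule.{u, w} Λ}
    (Q : ProjectiveResolution.{u, w} (F.res M)) :
    ProjectiveResolution.{u, max u w} (F.res (F.syzygy Q)) :=
  (F.exists_syzygyResolution Q).choose

theorem syzygyResolution_isFinitelyGenerated {M : ProfiniteModule.{u, w} Λ}
    (Q : ProjectiveResolution.{u, w} (F.res M)) (i : ℕ) (h₀ : (Q.X 0).IsFinitelyGenerated)
    (hi : (Q.X (i + 1)).IsFinitelyGenerated) :
    ((F.syzygyResolution Q).X i).IsFinitelyGenerated :=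
  (F.exists_syzygyResolution Q).choose_spec i h₀ hi

/-- The iterated syzygies of a module, with resolutions of their restrictions. -/
noncomputable def syzygySeq {M : ProfiniteModule.{u, w} Λ}
    (Q : ProjectiveResolution.{u, w} (F.res M)) :
    ℕ → Σ K : ProfiniteModule.{u, max u w} Λ, ProjectiveResolution.{u, max u w} (F.res K)
  | 0 => ⟨F.syzygy Q, F.syzygyResolution Q⟩
  | k + 1 => ⟨F.syzygy (syzygySeq Q k).2, F.syzygyResolution (syzygySeq Q k).2⟩

/-- Each syzygy costs one degree, and entry `k` is syzygy number `k + 1`, whence the bound `i + k +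
1 ≤ n`. -/
theorem syzygySeq_isFinitelyGenerated {M : ProfiniteModule.{u, w} Λ}
    (Q : ProjectiveResolution.{u, w} (F.res M)) (n : ℕ∞)
    (hQ : ∀ i : ℕ, (i : ℕ∞) ≤ n → (Q.X i).IsFinitelyGenerated) (k i : ℕ)
    (h : ((i + k + 1 : ℕ) : ℕ∞) ≤ n) : ((F.syzygySeq Q k).2.X i).IsFinitelyGenerated := by
  induction k generalizing i with
  | zero =>
    exact F.syzygyResolution_isFinitelyGenerated Q i (hQ 0 (by simp)) (hQ (i + 1) h)
  | succ k ih =>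
    refine F.syzygyResolution_isFinitelyGenerated _ i (ih 0 ?_) (ih (i + 1) ?_)
    · exact le_trans (by exact_mod_cast (by omega)) h
    · exact le_trans (by exact_mod_cast (by omega)) h

/-- A projective resolution built from iterated syzygies. -/
noncomputable def inducedResolution {M : ProfiniteModule.{u, w} Λ}
    (Q : ProjectiveResolution.{u, w} (F.res M)) : ProjectiveResolution.{u, w} M where
  X
    | 0 => F.induce (Q.X 0)
    | k + 1 => F.induce ((F.syzygySeq Q k).2.X 0)
  d
    | 0 => (kerSubtype (F.induceLift Q.ε)).comp (F.induceLift (F.syzygySeq Q 0).2.ε)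
    | k + 1 => (kerSubtype (F.induceLift (F.syzygySeq Q k).2.ε)).comp
        (F.induceLift (F.syzygySeq Q (k + 1)).2.ε)
  ε := F.induceLift Q.ε
  projective
    | 0 => F.induce_isProjective.{u, w} (Q.projective 0)
    | k + 1 => F.induce_isProjective.{u, w} ((F.syzygySeq Q k).2.projective 0)
  surjective_ε := F.induceLift_surjective Q.ε Q.surjective_ε
  exact_zero := exact_kerSubtype_comp _ _
    (F.induceLift_surjective _ (F.syzygySeq Q 0).2.surjective_ε)
  exact_succ
    | 0 => exact_kerSubtype_comp_kerSubtype_comp (F.induceLift Q.ε)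
        (F.induceLift (F.syzygySeq Q 0).2.ε) (F.induceLift (F.syzygySeq Q 1).2.ε)
        (F.induceLift_surjective _ (F.syzygySeq Q 1).2.surjective_ε)
    | k + 1 => exact_kerSubtype_comp_kerSubtype_comp (F.induceLift (F.syzygySeq Q k).2.ε)
        (F.induceLift (F.syzygySeq Q (k + 1)).2.ε) (F.induceLift (F.syzygySeq Q (k + 2)).2.ε)
        (F.induceLift_surjective _ (F.syzygySeq Q (k + 2)).2.surjective_ε)

theorem isFP_of_res {M : ProfiniteModule.{u, w} Λ} {n : ℕ∞} (h : (F.res M).IsFP n) :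
    M.IsFP n := by
  obtain ⟨Q, hQ⟩ := h
  refine ⟨F.inducedResolution Q, fun i hi => ?_⟩
  rcases i with _ | i
  · exact F.induce_isFinitelyGenerated (hQ 0 hi)
  · exact F.induce_isFinitelyGenerated (F.syzygySeq_isFinitelyGenerated Q n hQ i 0
      (by rwa [zero_add]))

end FrobeniusExtension

/-! ### Comparing open normal subgroups of `G` and of `H` -/

namespace OpenNormalSubgroup

variable {G : Type u} [Group G] [TopologicalSpace G]

/-- The intersection of an open normal subgroup with a subgroup. -/
def trace (U : OpenNormalSubgroup G) (H : Subgroup G) : OpenNormalSubgroup H where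
  toSubgroup := U.toSubgroup.subgroupOf H
  isOpen' := U.isOpen'.preimage continuous_subtype_val

theorem trace_mono {U V : OpenNormalSubgroup G} (h : U.toSubgroup ≤ V.toSubgroup)
    (H : Subgroup G) : (U.trace H).toSubgroup ≤ (V.trace H).toSubgroup :=
  fun _ hx => h hx

variable [IsTopologicalGroup G] [CompactSpace G] {H : OpenSubgroup G}

/-- The largest normal subgroup of `G` contained in an open normal subgroup of the open subgroup
`H` of `G`. -/
def core (V : OpenNormalSubgroup H.toSubgroup) : OpenNormalSubgroup G where
  toSubgroup := (V.toSubgroup.map H.toSubgroup.subtype).normalCore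
  isOpen' := by
    have ho : IsOpen (V.toSubgroup.map H.toSubgroup.subtype : Set G) := by
      rw [Subgroup.coe_map]
      exact H.isOpen.isOpenMap_subtype_val _ V.isOpen'
    have : Finite (G ⧸ V.toSubgroup.map H.toSubgroup.subtype) :=
      Subgroup.quotient_finite_of_isOpen _ ho
    have : (V.toSubgroup.map H.toSubgroup.subtype).FiniteIndex :=
      Subgroup.finiteIndex_of_finite_quotient
    -- Compactness gives finite index, which the normal core inherits; a closed subgroup of finite
    -- index is open.
    exact Subgroup.isOpen_of_isClosed_of_finiteIndex _
      (Subgroup.normalCore_isClosed _ (Subgroup.isClosed_of_isOpen _ ho))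

theorem core_le_map (V : OpenNormalSubgroup H.toSubgroup) :
    V.core.toSubgroup ≤ V.toSubgroup.map H.toSubgroup.subtype :=
  Subgroup.normalCore_le _

theorem core_le (V : OpenNormalSubgroup H.toSubgroup) : V.core.toSubgroup ≤ H.toSubgroup :=
  V.core_le_map.trans (Subgroup.map_subtype_le _)

theorem trace_core_le (V : OpenNormalSubgroup H.toSubgroup) :
    (V.core.trace H.toSubgroup).toSubgroup ≤ V.toSubgroup := by
  intro x hx
  obtain ⟨y, hy, hxy⟩ := V.core_le_map hx
  rwa [← Subtype.ext hxy]

theorem core_mono {V W : OpenNormalSubgroup H.toSubgroup} (h : V.toSubgroup ≤ W.toSubgroup) :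
    V.core.toSubgroup ≤ W.core.toSubgroup :=
  Subgroup.normalCore_mono (Subgroup.map_mono h)

/-- Composing `proj` with `incl` at level `U` reads the component at the core of the trace; this
inclusion provides the transition back to `U`. -/
theorem core_trace_le (U : OpenNormalSubgroup G) :
    (U.trace H.toSubgroup).core.toSubgroup ≤ U.toSubgroup := by
  intro x hx
  obtain ⟨y, hy, rfl⟩ := (U.trace H.toSubgroup).core_le_map hx
  exact hy

end OpenNormalSubgroup

/-! ### Additive maps of group algebras: checking on cosets, and continuity -/

theorem groupAlgebraTransition_single (R : Type v) [CommRing R] {G : Type u} [Group G]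
    [TopologicalSpace G] (U V : OpenNormalSubgroup G) (h : U.toSubgroup ≤ V.toSubgroup) (g : G)
    (r : R) :
    groupAlgebraTransition R U V h (MonoidAlgebra.single (g : G ⧸ U.toSubgroup) r) =
      MonoidAlgebra.single (g : G ⧸ V.toSubgroup) r :=
  MonoidAlgebra.mapDomain_single

theorem MonoidAlgebra.addMonoidHom_ext_quotient {R : Type*} [CommRing R] {G : Type*} [Group G]
    {U : Subgroup G} {A : Type*} [AddZeroClass A]
    {f g : R[G ⧸ U] →+ A}
    (h : ∀ (x : G) (r : R), f (single (x : G ⧸ U) r) = g (single (x : G ⧸ U) r)) : f = g :=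
  MonoidAlgebra.addMonoidHom_ext fun q r => by
    obtain ⟨x, rfl⟩ := QuotientGroup.mk_surjective q
    exact h x r

theorem MonoidAlgebra.continuous_coeff_addMonoidHom {R : Type*} [CommRing R] [TopologicalSpace R]
    [IsTopologicalRing R] {A B : Type*} [Finite A] (f : R[A] →+ R[B])
    (hf : ∀ p q, Continuous fun r => (f (single p r)).coeff q) {X : Type*} [TopologicalSpace X]
    {x : X → R[A]} (hx : ∀ p, Continuous fun t => (x t).coeff p) (q : B) :
    Continuous fun t => (f (x t)).coeff q := by
  have := Fintype.ofFinite A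
  have key : ∀ y : R[A], (f y).coeff q = ∑ p, (f (single p (y.coeff p))).coeff q := by
    intro y
    conv_lhs => rw [← sum_coeff_single y, Finsupp.sum_fintype _ _ fun _ => single_zero _, map_sum]
    rw [coeff_sum, Finsupp.finsetSum_apply]
  exact (continuous_finsetSum _ fun p _ => (hf p q).comp (hx p)).congr fun t => (key (x t)).symm

theorem MonoidAlgebra.continuous_coeff_single {R : Type*} [CommRing R] [TopologicalSpace R]
    {A : Type*} (p q : A) : Continuous fun r : R => (single p r).coeff q := by
  classical
  simp_rw [coeff_single, Finsupp.single_apply]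
  split_ifs <;> fun_prop

/-- Exactly one coset representative lies in `g H`; in the dual basis expansions this leaves a
single nonzero term. -/
theorem Subgroup.inv_mul_out_mem_iff {G : Type*} [Group G] {H : Subgroup G} {I : Type*}
    (e : G ⧸ H ≃ I) (g : G) (i : I) :
    g⁻¹ * (e.symm i).out ∈ H ↔ i = e g := by
  rw [← QuotientGroup.eq, QuotientGroup.out_eq', eq_comm, Equiv.symm_apply_eq]

/-! ### The Frobenius extension of complete group algebras for an open subgroup -/

namespace CompleteGroupAlgebra

section Subgroup

variable (R : Type v) [CommRing R] {G : Type u} [Group G] [TopologicalSpace G]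

/-- The element of `R⟦G⟧` given by an element of `G`. -/
noncomputable def of (g : G) : CompleteGroupAlgebra R G :=
  ⟨fun U => MonoidAlgebra.single (g : G ⧸ U.toSubgroup) 1,
    fun U V h => groupAlgebraTransition_single R U V h g 1⟩

theorem of_mul (g h : G) : of R (g * h) = of R g * of R h :=
  Subtype.ext (funext fun U => by
    change MonoidAlgebra.single ((g : G ⧸ U.toSubgroup) * h) (1 : R) =
      MonoidAlgebra.single (g : G ⧸ U.toSubgroup) 1 * MonoidAlgebra.single (h : G ⧸ U.toSubgroup) 1
    rw [MonoidAlgebra.single_mul_single, one_mul])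

/-- The map `R[H ⧸ U ∩ H] → R[G ⧸ U]`. -/
noncomputable def inclComponent (H : Subgroup G) (U : OpenNormalSubgroup G) :
    R[H ⧸ (U.trace H).toSubgroup] →+* R[G ⧸ U.toSubgroup] :=
  MonoidAlgebra.mapDomainRingHom R
    (QuotientGroup.map (U.trace H).toSubgroup U.toSubgroup H.subtype le_rfl)

theorem inclComponent_single (H : Subgroup G) (U : OpenNormalSubgroup G) (h : H) (r : R) :
    inclComponent R H U (MonoidAlgebra.single (h : H ⧸ (U.trace H).toSubgroup) r) =
      MonoidAlgebra.single ((h : G) : G ⧸ U.toSubgroup) r :=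
  MonoidAlgebra.mapDomain_single

theorem transition_inclComponent (H : Subgroup G) (U V : OpenNormalSubgroup G)
    (h : U.toSubgroup ≤ V.toSubgroup) (x : R[H ⧸ (U.trace H).toSubgroup]) :
    groupAlgebraTransition R U V h (inclComponent R H U x) =
      inclComponent R H V (groupAlgebraTransition R _ _ (OpenNormalSubgroup.trace_mono h H) x) := by
  refine DFunLike.congr_fun (f := (groupAlgebraTransition R U V h).toAddMonoidHom.comp
    (inclComponent R H U).toAddMonoidHom) (g := (inclComponent R H V).toAddMonoidHom.comp
    (groupAlgebraTransition R _ _ (OpenNormalSubgroup.trace_mono h H)).toAddMonoidHom) ?_ x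
  refine MonoidAlgebra.addMonoidHom_ext_quotient fun g r => ?_
  change groupAlgebraTransition R U V h (inclComponent R H U _) =
      inclComponent R H V (groupAlgebraTransition R _ _ (OpenNormalSubgroup.trace_mono h H) _)
  rw [inclComponent_single, groupAlgebraTransition_single, groupAlgebraTransition_single,
    inclComponent_single]

/-- The homomorphism `R⟦H⟧ → R⟦G⟧` for a subgroup `H` of `G`. -/
noncomputable def incl (H : Subgroup G) : CompleteGroupAlgebra R H →+* CompleteGroupAlgebra R G :=
  (RingHom.pi fun U : OpenNormalSubgroup G => (inclComponent R H U).comp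
    ((Pi.evalRingHom (fun V : OpenNormalSubgroup H => R[H ⧸ V.toSubgroup]) (U.trace H)).comp
      (completeGroupAlgebraSubring R H).subtype)).codRestrict (completeGroupAlgebraSubring R G)
    fun x U V h => by
      change groupAlgebraTransition R U V h (inclComponent R H U (x.1 _)) =
        inclComponent R H V (x.1 _)
      rw [transition_inclComponent, x.2]

theorem augmentation_apply (x : CompleteGroupAlgebra R G) :
    augmentation R G x = (x.1 (OpenNormalSubgroup.whole G)).coeff 1 := by
  have hs : Subsingleton (G ⧸ (OpenNormalSubgroup.whole G).toSubgroup) :=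
    QuotientGroup.subsingleton_quotient_top
  change MonoidAlgebra.lift R R _ 1 (x.1 (OpenNormalSubgroup.whole G)) = _
  rw [MonoidAlgebra.lift_apply, Finsupp.sum_eq_single 1]
  · simp
  · exact fun b _ hb => (hb (Subsingleton.elim _ _)).elim
  · simp

theorem augmentation_incl (H : Subgroup G) (x : CompleteGroupAlgebra R H) :
    augmentation R G (incl R H x) = augmentation R H x := by
  have h₁ : (OpenNormalSubgroup.whole G).trace H = OpenNormalSubgroup.whole H := rfl
  change MonoidAlgebra.lift R R _ 1 (inclComponent R H _ (x.1 _)) =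
    MonoidAlgebra.lift R R _ 1 (x.1 (OpenNormalSubgroup.whole H))
  rw [← h₁]
  generalize x.1 ((OpenNormalSubgroup.whole G).trace H) = y
  induction y using MonoidAlgebra.induction_linear with
  | zero => simp
  | add y z hy hz => rw [map_add, map_add, hy, hz, map_add]
  | single q r =>
    obtain ⟨h, rfl⟩ := QuotientGroup.mk_surjective q
    rw [inclComponent_single]
    simp

/-- As `U ≤ H`, membership in `H` depends only on the coset modulo `U`. This is why the projection
is defined on components at cores. -/
theorem mem_range_map_subtype_iff {H : OpenSubgroup G} (U : OpenNormalSubgroup G)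
    (hU : U.toSubgroup ≤ H.toSubgroup)
    (g : G) : (g : G ⧸ U.toSubgroup) ∈ Set.range (QuotientGroup.map
      (U.trace H.toSubgroup).toSubgroup U.toSubgroup H.toSubgroup.subtype le_rfl) ↔
    g ∈ H.toSubgroup := by
  constructor
  · rintro ⟨q, hq⟩
    obtain ⟨h, rfl⟩ := QuotientGroup.mk_surjective q
    have h₁ : (h : G)⁻¹ * g ∈ H.toSubgroup := hU (QuotientGroup.eq.1 hq)
    exact (Subgroup.mul_mem_cancel_left _ (inv_mem h.2)).1 h₁
  · exact fun h => ⟨((⟨g, h⟩ : H.toSubgroup) : _ ⧸ (U.trace H.toSubgroup).toSubgroup), rfl⟩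

theorem map_subtype_injective (H : Subgroup G) (U : OpenNormalSubgroup G) :
    Function.Injective (QuotientGroup.map
      (U.trace H).toSubgroup U.toSubgroup H.subtype le_rfl) := by
  rw [injective_iff_map_eq_one]
  intro q hq
  obtain ⟨h, rfl⟩ := QuotientGroup.mk_surjective q
  exact (QuotientGroup.eq_one_iff _).2 ((QuotientGroup.eq_one_iff (N := U.toSubgroup) _).1 hq)

section Projection

variable [IsTopologicalGroup G] [CompactSpace G] {H : OpenSubgroup G}

/-- The component `R[G ⧸ core V] → R[H ⧸ V]` of the projection `R⟦G⟧ → R⟦H⟧`. -/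
noncomputable def projComponent (V : OpenNormalSubgroup H.toSubgroup) :
    R[G ⧸ V.core.toSubgroup] →+ R[H.toSubgroup ⧸ V.toSubgroup] :=
  (groupAlgebraTransition R _ V V.trace_core_le).toAddMonoidHom.comp
    (MonoidAlgebra.comapDomainAddMonoidHom _ (map_subtype_injective H.toSubgroup V.core))

theorem projComponent_single_mem (V : OpenNormalSubgroup H.toSubgroup) (h : H.toSubgroup) (r : R) :
    projComponent R V (MonoidAlgebra.single ((h : G) : G ⧸ V.core.toSubgroup) r) =
      MonoidAlgebra.single (h : H.toSubgroup ⧸ V.toSubgroup) r :=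
  (congrArg (groupAlgebraTransition R _ V V.trace_core_le)
    (MonoidAlgebra.comapDomain_single_map _ (map_subtype_injective H.toSubgroup V.core)
      (h : H.toSubgroup ⧸ (V.core.trace H.toSubgroup).toSubgroup) r)).trans
    (groupAlgebraTransition_single R _ _ _ _ _)

theorem projComponent_single_not_mem (V : OpenNormalSubgroup H.toSubgroup) {g : G}
    (hg : g ∉ H.toSubgroup) (r : R) :
    projComponent R V (MonoidAlgebra.single (g : G ⧸ V.core.toSubgroup) r) = 0 :=
  (congrArg (groupAlgebraTransition R _ V V.trace_core_le)
    (MonoidAlgebra.comapDomain_single_of_not_mem_range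
      (by rwa [mem_range_map_subtype_iff _ V.core_le])
      (map_subtype_injective H.toSubgroup V.core))).trans (map_zero _)

theorem transition_projComponent (V W : OpenNormalSubgroup H.toSubgroup)
    (h : V.toSubgroup ≤ W.toSubgroup) (x : R[G ⧸ V.core.toSubgroup]) :
    groupAlgebraTransition R V W h (projComponent R V x) =
      projComponent R W (groupAlgebraTransition R _ _ (OpenNormalSubgroup.core_mono h) x) := by
  refine DFunLike.congr_fun (f := (groupAlgebraTransition R V W h).toAddMonoidHom.comp
    (projComponent R V)) (g := (projComponent R W).comp
    (groupAlgebraTransition R _ _ (OpenNormalSubgroup.core_mono h)).toAddMonoidHom) ?_ x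
  refine MonoidAlgebra.addMonoidHom_ext_quotient fun g r => ?_
  change groupAlgebraTransition R V W h (projComponent R V _) =
    projComponent R W (groupAlgebraTransition R _ _ (OpenNormalSubgroup.core_mono h) _)
  rw [groupAlgebraTransition_single]
  by_cases hg : g ∈ H.toSubgroup
  · lift g to H.toSubgroup using hg
    rw [projComponent_single_mem, projComponent_single_mem, groupAlgebraTransition_single]
  · rw [projComponent_single_not_mem R V hg, projComponent_single_not_mem R W hg, map_zero]

variable (H) in
/-- The projection `R⟦G⟧ → R⟦H⟧` for an open subgroup `H` of `G`, which maps the elements of `G`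
outside `H` to zero. -/
noncomputable def proj : CompleteGroupAlgebra R G →+ CompleteGroupAlgebra R H.toSubgroup where
  toFun x := ⟨fun V => projComponent R V (x.1 V.core), fun V W h => by
    rw [transition_projComponent, x.2]⟩
  map_zero' := Subtype.ext (funext fun V => map_zero (projComponent R V))
  map_add' x y := Subtype.ext (funext fun V => map_add (projComponent R V) _ _)

/-- By biadditivity this reduces to group elements, where multiplying by an element of `H` does not
affect membership in `H`. -/
theorem projComponent_incl_mul (V : OpenNormalSubgroup H.toSubgroup)
    (a : R[H.toSubgroup ⧸ (V.core.trace H.toSubgroup).toSubgroup])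
    (x : R[G ⧸ V.core.toSubgroup]) :
    projComponent R V (inclComponent R H.toSubgroup V.core a * x) =
      groupAlgebraTransition R _ V V.trace_core_le a * projComponent R V x := by
  induction a using MonoidAlgebra.induction_linear with
  | zero => simp
  | add a b ha hb => rw [map_add, add_mul, map_add, ha, hb, map_add, add_mul]
  | single p r =>
  induction x using MonoidAlgebra.induction_linear with
  | zero => simp
  | add x y hx hy => rw [mul_add, map_add, hx, hy, map_add, mul_add]
  | single q s =>
  obtain ⟨h, rfl⟩ := QuotientGroup.mk_surjective p
  obtain ⟨g, rfl⟩ := QuotientGroup.mk_surjective q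
  rw [inclComponent_single, groupAlgebraTransition_single, MonoidAlgebra.single_mul_single,
    ← QuotientGroup.mk_mul]
  by_cases hg : g ∈ H.toSubgroup
  · lift g to H.toSubgroup using hg
    rw [← Subgroup.coe_mul, projComponent_single_mem, projComponent_single_mem,
      MonoidAlgebra.single_mul_single, ← QuotientGroup.mk_mul]
  · rw [projComponent_single_not_mem R V hg, projComponent_single_not_mem R V
      (by rwa [Subgroup.mul_mem_cancel_left _ h.2]), mul_zero]

theorem projComponent_mul_incl (V : OpenNormalSubgroup H.toSubgroup)
    (x : R[G ⧸ V.core.toSubgroup])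
    (a : R[H.toSubgroup ⧸ (V.core.trace H.toSubgroup).toSubgroup]) :
    projComponent R V (x * inclComponent R H.toSubgroup V.core a) =
      projComponent R V x * groupAlgebraTransition R _ V V.trace_core_le a := by
  induction a using MonoidAlgebra.induction_linear with
  | zero => simp
  | add a b ha hb => rw [map_add, mul_add, map_add, ha, hb, map_add, mul_add]
  | single p r =>
  induction x using MonoidAlgebra.induction_linear with
  | zero => simp
  | add x y hx hy => rw [add_mul, map_add, hx, hy, map_add, add_mul]
  | single q s =>
  obtain ⟨h, rfl⟩ := QuotientGroup.mk_surjective p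
  obtain ⟨g, rfl⟩ := QuotientGroup.mk_surjective q
  rw [inclComponent_single, groupAlgebraTransition_single, MonoidAlgebra.single_mul_single,
    ← QuotientGroup.mk_mul]
  by_cases hg : g ∈ H.toSubgroup
  · lift g to H.toSubgroup using hg
    rw [← Subgroup.coe_mul, projComponent_single_mem, projComponent_single_mem,
      MonoidAlgebra.single_mul_single, ← QuotientGroup.mk_mul]
  · rw [projComponent_single_not_mem R V hg, projComponent_single_not_mem R V
      (by rwa [Subgroup.mul_mem_cancel_right _ h.2]), zero_mul]

theorem proj_incl_mul (a : CompleteGroupAlgebra R H.toSubgroup) (x : CompleteGroupAlgebra R G) :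
    proj R H (incl R H.toSubgroup a * x) = a * proj R H x := by
  refine Subtype.ext (funext fun V => ?_)
  refine (projComponent_incl_mul R V (a.1 _) (x.1 V.core)).trans ?_
  rw [a.2]
  rfl

theorem proj_mul_incl (x : CompleteGroupAlgebra R G) (a : CompleteGroupAlgebra R H.toSubgroup) :
    proj R H (x * incl R H.toSubgroup a) = proj R H x * a := by
  refine Subtype.ext (funext fun V => ?_)
  refine (projComponent_mul_incl R V (x.1 V.core) (a.1 _)).trans ?_
  rw [a.2]
  rfl

theorem proj_of_coe (h : H.toSubgroup) : proj R H (of R (h : G)) = of R h :=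
  Subtype.ext (funext fun V => projComponent_single_mem R V h 1)

theorem proj_of_not_mem {g : G} (hg : g ∉ H.toSubgroup) : proj R H (of R g) = 0 :=
  Subtype.ext (funext fun V => projComponent_single_not_mem R V hg 1)

open Classical in
theorem inclComponent_projComponent_single (U : OpenNormalSubgroup G) (g : G) (r : R) :
    inclComponent R H.toSubgroup U (projComponent R (U.trace H.toSubgroup)
      (MonoidAlgebra.single (g : G ⧸ (U.trace H.toSubgroup).core.toSubgroup) r)) =
    if g ∈ H.toSubgroup then MonoidAlgebra.single (g : G ⧸ U.toSubgroup) r else 0 := by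
  split_ifs with hg
  · lift g to H.toSubgroup using hg
    rw [projComponent_single_mem, inclComponent_single]
  · rw [projComponent_single_not_mem R _ hg, map_zero]

section DualBases

variable {I : Type*} (e : G ⧸ H.toSubgroup ≃ I)

theorem sum_incl_proj_mul [Fintype I] (x : CompleteGroupAlgebra R G) :
    ∑ i, incl R H.toSubgroup (proj R H (x * of R (e.symm i).out)) * of R (e.symm i).out⁻¹ = x := by
  classical
  refine Subtype.ext (funext fun U => ?_)
  rw [AddSubmonoidClass.coe_finsetSum, Finset.sum_apply]
  change ∑ i, inclComponent R H.toSubgroup U (projComponent R (U.trace H.toSubgroup)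
    (x.1 _ * MonoidAlgebra.single _ 1)) * MonoidAlgebra.single _ 1 = x.1 U
  -- Compatibility rewrites `x.1 U` through the deeper component used on the left, so the identity
  -- concerns one element of one group algebra and can be checked on group elements.
  rw [← x.2 _ U U.core_trace_le]
  generalize x.1 (U.trace H.toSubgroup).core = y
  induction y using MonoidAlgebra.induction_linear with
  | zero => simp
  | add y z hy hz => simp_rw [add_mul, map_add, add_mul, Finset.sum_add_distrib, hy, hz]
  | single q r =>
    obtain ⟨g, rfl⟩ := QuotientGroup.mk_surjective q
    simp_rw [MonoidAlgebra.single_mul_single, ← QuotientGroup.mk_mul,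
      inclComponent_projComponent_single, ite_mul, zero_mul, MonoidAlgebra.single_mul_single,
      ← QuotientGroup.mk_mul, mul_one, mul_inv_cancel_right, groupAlgebraTransition_single]
    -- For a group element `g`, the product `g * t i` lies in `H` only for the coset of `g⁻¹`, and
    -- then `g * t i * (t i)⁻¹ = g`.
    have := Subgroup.inv_mul_out_mem_iff e g⁻¹
    simp_rw [inv_inv] at this
    simp_rw [this]
    simp

theorem sum_mul_incl_proj [Fintype I] (x : CompleteGroupAlgebra R G) :
    ∑ i, of R (e.symm i).out * incl R H.toSubgroup (proj R H (of R (e.symm i).out⁻¹ * x)) = x := by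
  classical
  refine Subtype.ext (funext fun U => ?_)
  rw [AddSubmonoidClass.coe_finsetSum, Finset.sum_apply]
  change ∑ i, MonoidAlgebra.single _ 1 * inclComponent R H.toSubgroup U (projComponent R
    (U.trace H.toSubgroup) (MonoidAlgebra.single _ 1 * x.1 _)) = x.1 U
  rw [← x.2 _ U U.core_trace_le]
  generalize x.1 (U.trace H.toSubgroup).core = y
  induction y using MonoidAlgebra.induction_linear with
  | zero => simp
  | add y z hy hz => simp_rw [mul_add, map_add, mul_add, Finset.sum_add_distrib, hy, hz]
  | single q r =>
    obtain ⟨g, rfl⟩ := QuotientGroup.mk_surjective q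
    simp_rw [MonoidAlgebra.single_mul_single, ← QuotientGroup.mk_mul,
      inclComponent_projComponent_single, mul_ite, mul_zero, MonoidAlgebra.single_mul_single,
      ← QuotientGroup.mk_mul, one_mul, mul_inv_cancel_left, groupAlgebraTransition_single]
    have : ∀ i, (e.symm i).out⁻¹ * g ∈ H.toSubgroup ↔ i = e g := fun i => by
      rw [← Subgroup.inv_mul_out_mem_iff e, ← inv_mem_iff, mul_inv_rev, inv_inv]
    simp_rw [this]
    simp

theorem proj_of_inv_mul_of [DecidableEq I] (i j : I) :
    proj R H (of R (e.symm i).out⁻¹ * of R (e.symm j).out) = if i = j then 1 else 0 := by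
  rw [← of_mul]
  split_ifs with h
  · subst h
    rw [inv_mul_cancel]
    exact proj_of_coe R (1 : H.toSubgroup)
  · refine proj_of_not_mem R fun hm => h ?_
    rw [Subgroup.inv_mul_out_mem_iff, QuotientGroup.out_eq', Equiv.apply_symm_apply] at hm
    exact hm.symm

end DualBases

variable [TopologicalSpace R] [IsTopologicalRing R]

theorem continuous_incl : Continuous (incl R H.toSubgroup) := by
  rw [continuous_iff]
  intro U q
  have : Finite (H.toSubgroup ⧸ (U.trace H.toSubgroup).toSubgroup) :=
    Subgroup.quotient_finite_of_isOpen _ (U.trace H.toSubgroup).isOpen'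
  refine MonoidAlgebra.continuous_coeff_addMonoidHom
    (inclComponent R H.toSubgroup U).toAddMonoidHom (fun p q => ?_)
    (continuous_coeff R H.toSubgroup (U.trace H.toSubgroup)) q
  obtain ⟨h, rfl⟩ := QuotientGroup.mk_surjective p
  exact (MonoidAlgebra.continuous_coeff_single ((h : G) : G ⧸ U.toSubgroup) q).congr fun r => by
    rw [← inclComponent_single]; rfl

theorem continuous_proj : Continuous (proj R H) := by
  rw [continuous_iff]
  intro V q
  have : Finite (G ⧸ V.core.toSubgroup) := Subgroup.quotient_finite_of_isOpen _ V.core.isOpen'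
  refine MonoidAlgebra.continuous_coeff_addMonoidHom (projComponent R V) (fun p q => ?_)
    (continuous_coeff R G V.core) q
  obtain ⟨g, rfl⟩ := QuotientGroup.mk_surjective p
  by_cases hg : g ∈ H.toSubgroup
  · lift g to H.toSubgroup using hg
    simp_rw [projComponent_single_mem]
    exact MonoidAlgebra.continuous_coeff_single _ q
  · simp_rw [projComponent_single_not_mem R V hg]
    exact continuous_const

/-- The complete group algebra of `G` is a Frobenius extension of that of an open subgroup. -/
noncomputable def frobeniusExtension {I : Type} [Fintype I] [DecidableEq I]
    (e : G ⧸ H.toSubgroup ≃ I) :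
    FrobeniusExtension (CompleteGroupAlgebra R H.toSubgroup) (CompleteGroupAlgebra R G) I where
  incl := incl R H.toSubgroup
  continuous_incl := continuous_incl R
  proj := proj R H
  continuous_proj := continuous_proj R
  proj_incl_mul := proj_incl_mul R
  proj_mul_incl := proj_mul_incl R
  basis i := of R (e.symm i).out
  dual i := of R (e.symm i).out⁻¹
  sum_proj_mul_dual := sum_incl_proj_mul R e
  sum_basis_mul_proj := sum_mul_incl_proj R e
  proj_dual_mul_basis := proj_of_inv_mul_of R e

end Projection

end Subgroup

end CompleteGroupAlgebra

/-! ### The complete group algebra of the trivial group -/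

namespace CompleteGroupAlgebra

variable (R : Type v) [CommRing R] (G : Type u) [Group G] [TopologicalSpace G]

theorem augmentation_bijective [Subsingleton G] : Function.Bijective (augmentation R G) := by
  constructor
  · intro x y hxy
    rw [augmentation_apply, augmentation_apply] at hxy
    refine coeffs_injective R G (funext fun U => funext fun q => ?_)
    obtain rfl : U = OpenNormalSubgroup.whole G :=
      OpenNormalSubgroup.toSubgroup_injective (Subsingleton.elim _ _)
    obtain ⟨g, rfl⟩ := QuotientGroup.mk_surjective q
    rw [Subsingleton.elim g 1]
    exact hxy
  · intro r
    refine ⟨⟨fun U => MonoidAlgebra.single ((1 : G) : G ⧸ U.toSubgroup) r,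
      fun U V h => groupAlgebraTransition_single R U V h 1 r⟩, ?_⟩
    rw [augmentation_apply]
    exact Finsupp.single_eq_same

end CompleteGroupAlgebra

/-! ### Type `FP_n` for open subgroups and for finite groups -/

section GroupFP

open CompleteGroupAlgebra ProfiniteModule

variable (R : Type v) [CommRing R] [TopologicalSpace R] [IsTopologicalRing R]
    [CompactSpace R] [T2Space R] [TotallyDisconnectedSpace R]
    (G : Type u) [Group G] [TopologicalSpace G] [IsTopologicalGroup G] [CompactSpace G]

/-- The complete group algebra as a profinite module over itself. -/
noncomputable def ProfiniteModule.self :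
    ProfiniteModule.{max u v, max u v} (CompleteGroupAlgebra R G) where
  carrier := CompleteGroupAlgebra R G

theorem ProfiniteModule.self_isProjective :
    IsProjective.{max u v, v} (ProfiniteModule.self R G) := by
  intro A B f g hf
  obtain ⟨a, ha⟩ := hf (g (1 : CompleteGroupAlgebra R G))
  refine ⟨(ContinuousLinearMap.toSpanSingleton (CompleteGroupAlgebra R G) a :
    CompleteGroupAlgebra R G →L[CompleteGroupAlgebra R G] A),
    ContinuousLinearMap.ext fun (x : CompleteGroupAlgebra R G) => ?_⟩
  change f (x • a) = g x
  rw [map_smul, ha]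
  exact (g.map_smul' x (1 : CompleteGroupAlgebra R G)).symm.trans (congrArg g (mul_one x))

theorem ProfiniteModule.self_isFinitelyGenerated :
    (ProfiniteModule.self R G).IsFinitelyGenerated := by
  refine isFinitelyGenerated_of_finite ⟨{(1 : CompleteGroupAlgebra R G)}, Set.finite_singleton _,
    ?_⟩
  have : Submodule.span (CompleteGroupAlgebra R G) {(1 : CompleteGroupAlgebra R G)} = ⊤ :=
    Ideal.span_singleton_one
  exact fun x => subset_closure (this.ge (Submodule.mem_top (x := x)))

/-- The zero module as a profinite module. -/
def ProfiniteModule.zero (Λ : Type u) [Ring Λ] [TopologicalSpace Λ] : ProfiniteModule.{u, w} Λ where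
  carrier := PUnit

variable [T2Space G] [TotallyDisconnectedSpace G]

theorem isGroupFP_iff_of_openSubgroup (H : OpenSubgroup G) (n : ℕ∞) :
    IsGroupFP R H.toSubgroup n ↔ IsGroupFP R G n := by
  have : Finite (G ⧸ H.toSubgroup) := Subgroup.quotient_finite_of_isOpen _ H.isOpen
  -- Indexing cosets by `Fin k` puts the index type in the universe required by
  -- `FrobeniusExtension`.
  obtain ⟨k, ⟨e⟩⟩ := Finite.exists_equiv_fin (G ⧸ H.toSubgroup)
  let F := frobeniusExtension R e
  have hs : ∀ (a : CompleteGroupAlgebra R H.toSubgroup) (r : R),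
      augmentation R G (F.incl a) * r = augmentation R H.toSubgroup a * r := fun a r =>
    congrArg (· * r) (augmentation_incl R H.toSubgroup a)
  -- The two module structures on `R` agree because the augmentations do, so the identity is linear
  -- both ways.
  let f : F.res (trivial R G) →L[CompleteGroupAlgebra R H.toSubgroup] trivial R H.toSubgroup :=
    { toFun := fun r => r
      map_add' := fun _ _ => rfl
      map_smul' := hs
      cont := continuous_id (X := R) }
  let g : trivial R H.toSubgroup →L[CompleteGroupAlgebra R H.toSubgroup] F.res (trivial R G) :=
    { toFun := fun r => r
      map_add' := fun _ _ => rfl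
      map_smul' := fun a r => (hs a r).symm
      cont := continuous_id (X := R) }
  exact ⟨fun h => F.isFP_of_res (h.of_bijective g Function.bijective_id),
    fun h => (F.res_isFP h).of_bijective f Function.bijective_id⟩

/-- The augmentation is bijective, so the free module of rank one, followed by zeros, is already a
resolution. -/
theorem isGroupFP_of_subsingleton [Subsingleton G] : IsGroupFP R G ⊤ := by
  let Z : ProfiniteModule.{max u v, max u v} (CompleteGroupAlgebra R G) := ProfiniteModule.zero _
  have hZ : Subsingleton Z := inferInstanceAs (Subsingleton PUnit)
  have hε : Function.Bijective (augmentation R G) := augmentation_bijective R G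
  let X : ℕ → ProfiniteModule.{max u v, max u v} (CompleteGroupAlgebra R G)
    | 0 => ProfiniteModule.self R G
    | _ + 1 => Z
  let ε : ProfiniteModule.self R G →L[CompleteGroupAlgebra R G] trivial R G :=
    { toFun := augmentation R G
      map_add' := map_add (augmentation R G)
      map_smul' := map_mul (augmentation R G)
      cont := continuous_augmentation R G }
  refine ⟨{
    X := X
    d := fun i => 0
    ε := ε
    projective := ?_
    surjective_ε := hε.2
    exact_zero := ?_
    exact_succ := ?_ }, ?_⟩
  · rintro (_ | i)
    · exact ProfiniteModule.self_isProjective R G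
    · intro A B f g _
      refine ⟨0, ?_⟩
      ext z
      rw [show z = 0 from hZ.elim _ _, map_zero, map_zero]
  · intro x
    constructor
    · intro hx
      exact ⟨0, (hε.1 (hx.trans (map_zero (augmentation R G)).symm)).symm⟩
    · rintro ⟨z, rfl⟩
      exact map_zero (augmentation R G)
  · intro i x
    have hx : x = 0 := hZ.elim _ _
    exact ⟨fun _ => ⟨0, hx.symm⟩, fun _ => rfl⟩
  · rintro (_ | i) -
    · exact ProfiniteModule.self_isFinitelyGenerated R G
    · exact isFinitelyGenerated_of_finite ⟨∅, Set.finite_empty, fun z => by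
        rw [show z = 0 from hZ.elim _ _]
        exact subset_closure (Submodule.zero_mem (M := Z) _)⟩

end GroupFP

theorem lemma3p3 (R : Type v) [CommRing R] [TopologicalSpace R] [IsTopologicalRing R]
    [CompactSpace R] [T2Space R] [TotallyDisconnectedSpace R]
    (G : Type u) [Group G] [TopologicalSpace G] [IsTopologicalGroup G] [CompactSpace G]
    [T2Space G] [TotallyDisconnectedSpace G] :
    (∀ (H : OpenSubgroup G) (n : ℕ∞), IsGroupFP R H.toSubgroup n ↔ IsGroupFP R G n) ∧
      (Finite G → IsGroupFP R G ⊤) := by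
  refine ⟨isGroupFP_iff_of_openSubgroup R G, fun _ => ?_⟩
  have : Subsingleton (⊥ : Subgroup G) := inferInstance
  -- A finite Hausdorff group is discrete, which makes `⊥` an open subgroup.
  exact (isGroupFP_iff_of_openSubgroup R G ⟨⊥, isOpen_discrete _⟩ ⊤).1
    (isGroupFP_of_subsingleton R (⊥ : Subgroup G))
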